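/- **Setting.** Let $d\ge 2$, $\beta>1$, $R>0$, $\delta>0$. For $\eta,\eta'\in\{0,1\}$ let $Q^\eta:(\mathbb R^d)^5\to\mathbb C$ with $Q^\eta,|Q^\eta|\in W^{1,1}\cap W^{1,\infty}$ and $M^{\eta,\eta'}:\mathbb R^d\to\mathbb C$ with $M^{\eta,\eta'}\in W^{1,1}\cap W^{1,\infty}$, $\overline{M^{\eta,\eta'}}=M^{\eta',\eta}$, $M^{\eta,\eta'}$ supported in the ball of radius $R$ around $0$ (all functions are represented by their continuous representatives). Put $Q^\eta_+=Q^\eta$, $Q^\eta_-=\overline{Q^\eta}$, $z^+=z$, $z^-=\bar z$, $\overline\eta=1-\eta$. For $L\ge1$ let $\mathbb Z_L^d=L^{-1}\mathbb Z^d$ and $\epsilon=L^{-1/\beta}$. **Trees and couples.** A signed and coloured tree is a finite rooted ordered tree in which every branching node has exactly five children, with a sign $\iota\in\{\pm\}$ and a colour $\eta\in\{0,1\}$ at each vertex such that the children of a node with labels $(\iota,\eta)$ have, from left to right, the labels $(\iota,\eta),(-\iota,\eta),(-\iota,\eta),(\iota,\overline\eta),(\iota,\overline\eta)$. A couple $C=(T,T',\sigma)$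 consists of two such trees and an involution $\sigma$ of the set $\mathcal L(C)$ of all leaves of both trees that exchanges negative and positive leaves. $\mathcal N(C)$ is the set of branching nodes of both trees, $n(C)=|\mathcal N(C)|$, $\mathcal L(C)_+$ is the set of positive leaves, and $\leq$ is the order in which descendants are smaller. For $\kappa\in(\mathbb R^d)^{\mathcal L(C)_+}$ let $K_C(\ell)(\kappa)=\kappa(\ell)$ for a positive leaf $\ell$, $K_C(\ell)(\kappa)=-\kappa(\sigma(\ell))$ for a negative leaf, and $K_C(n)=\sum_{\mathcal L(C)\ni\ell\le n}K_C(\ell)$ for a node $n$. For $k\in\mathbb Z_L^d$, $\mathcal D_k(C)$ is the set of $\kappa\in(\mathbb Z_L^d)^{\mathcal L(C)_+}$ for which the left root has wave number $k$. For a node $n$ with children $n_1,\dots,n_5$ (left to right) let $$\Omega_n=\iota_n|K_C(n)|^2-\sum_{i=1}^5\iota_{n_i}|K_C(n_i)|^2,\qquad Q_n=Q^{\eta_n}_{\iota_n}\big(K_C(n_1),\dots,K_C(n_5)\big).$$ The node $n$ is resonant if its children can be enumerated as $m_1,\dots,m_5$ such that $\iota_{m_1}+\iota_{m_2}=0=\iota_{m_3}+\iota_{m_4}$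 and, identically as linear maps of $\kappa$, $K_C(m_1)+K_C(m_2)=0$, $K_C(m_3)+K_C(m_4)=0$, $K_C(m_5)=K_C(n)$. With $I_C(t)=\{(t_n)\in[0,t]^{\mathcal N(C)}: t_n\le t_{n'}\text{ if }n\le n'\}$ set $$\mathcal J_C(\epsilon^{-1}t,k)=\Big(\frac{-i}{L^{2d}}\Big)^{n(C)}\prod_{n\in\mathcal N(C)}\iota_n\sum_{\kappa\in\mathcal D_k(C)}\prod_{n\in\mathcal N(C)}Q_n\int_{I_C(t)}\prod_{n\in\mathcal N(C)}e^{i\iota_n\epsilon^{-1}\Omega_nt_n}\,dt_n\prod_{\ell\in\mathcal L(C)_+}M^{\eta_\ell,\eta_{\sigma(\ell)}}(\kappa(\ell))^{\iota_\ell}$$ (the integral is $1$ if $\mathcal N(C)=\emptyset$). **Theorem.** There is $\alpha>0$, depending only on $d$ and $\beta$, and there is $\Lambda>0$, depending only on $d,\beta,R,\delta,(Q^\eta)_\eta,(M^{\eta,\eta'})_{\eta,\eta'}$, such that for every couple $C$ that contains at least one non-resonant node, every $L\ge1$ and every $k\in\mathbb Z_L^d$, $$\sup_{t\in[0,\delta]}\big|\mathcal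 J_C(\epsilon^{-1}t,k)\big|\le\Lambda^{n(C)+1}\epsilon^{\alpha}.$$ As a consequence, only fully resonant couples contribute in the large-box limit, order by order: for fixed $n_1,n_2\in\mathbb N$, signs $\iota_1,\iota_2$ and colours $\eta_1,\eta_2$, let $\mathcal C$ be the (finite) set of couples whose left and right tree have $n_1$ and $n_2$ branching nodes, root signs $\iota_1$, $\iota_2$ and root colours $\eta_1$, $\eta_2$. Then $$\lim_{L\to\infty}\ \sup_{k\in\mathbb Z_L^d}\ \sup_{t\in[0,\delta]}\Big|\sum_{C\in\mathcal C}\mathcal J_C(\epsilon^{-1}t,k)-\sum_{\substack{C\in\mathcal C\\\text{all nodes of }C\text{ resonant}}}\mathcal J_C(\epsilon^{-1}t,k)\Big|=0 .$$ -/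

import Mathlib

open scoped ContDiff ComplexConjugate

noncomputable section

namespace QuinticNLS

/-! ### Function spaces and the momentum lattice -/

/-- The momentum space `ℝ^d` with its Euclidean norm. -/
abbrev Vec (d : ℕ) : Type := EuclideanSpace ℝ (Fin d)

/-- The rescaled lattice `ℤ_L^d = L⁻¹ ℤ^d`. -/
def lattice (d : ℕ) (L : ℝ) : Set (Vec d) :=
  {x | ∃ m : Fin d → ℤ, ∀ i, x i = (m i : ℝ) / L}

/-- The Sobolev space `W^{1,p}` of complex-valued functions: `f` and all its weak directional
derivatives belong to `L^p`. -/
def MemSobolevOne {V : Type*} [NormedAddCommGroup V] [NormedSpace ℝ V] [MeasureTheory.MeasureSpace V]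
    (p : ENNReal) (f : V → ℂ) : Prop :=
  MeasureTheory.MemLp f p MeasureTheory.volume ∧
  ∀ v : V, ∃ g : V → ℂ, MeasureTheory.MemLp g p MeasureTheory.volume ∧
    ∀ φ : V → ℝ, ContDiff ℝ ∞ φ → HasCompactSupport φ →
      ∫ x, ((fderiv ℝ φ x v : ℝ) : ℂ) * f x = - ∫ x, ((φ x : ℝ) : ℂ) * g x

/-- `f` is the continuous representative of an element of `W^{1,1} ∩ W^{1,∞}`; point values of `f`
(on the lattice) are therefore meaningful. -/
def SobolevClass {V : Type*} [NormedAddCommGroup V] [NormedSpace ℝ V] [MeasureTheory.MeasureSpace V]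
    (f : V → ℂ) : Prop :=
  Continuous f ∧ MemSobolevOne 1 f ∧ MemSobolevOne ⊤ f

/-! ### Signed and coloured 5-ary trees

Signs are elements of `ℤˣ = {1, -1}`, colours are elements of `Fin 2 = {0, 1}`, and the opposite
colour of `η` is `1 - η`. -/

/-- `z^+ = z` and `z^- = conj z`. -/
def signConj (ι : ℤˣ) (z : ℂ) : ℂ := if ι = 1 then z else conj z

/-- Signs of the five children (from left to right) of a node of sign `ι`. -/
def childSign (ι : ℤˣ) : Fin 5 → ℤˣ := ![ι, -ι, -ι, ι, ι]

/-- Colours of the five children (from left to right) of a node of colour `η`. -/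
def childColour (η : Fin 2) : Fin 5 → Fin 2 := ![η, η, η, 1 - η, 1 - η]

/-- Rooted ordered 5-ary trees. -/
inductive QuinTree : Type
  | leaf : QuinTree
  | node (children : Fin 5 → QuinTree) : QuinTree

/-- A vertex of a tree is given by its address, the list of child indices on the way down from
the root. `T.nodes` is the set of branching nodes. -/
def QuinTree.nodes : QuinTree → Finset (List (Fin 5))
  | .leaf => ∅
  | .node c => insert [] (Finset.univ.biUnion fun i => (c i).nodes.image (List.cons i))

/-- The set of (addresses of) leaves of a tree. -/
def QuinTree.leaves : QuinTree → Finset (List (Fin 5))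
  | .leaf => {[]}
  | .node c => Finset.univ.biUnion fun i => (c i).leaves.image (List.cons i)

/-- The sign of the vertex with address `p` in a tree whose root has sign `ι`. -/
def signAt (ι : ℤˣ) : List (Fin 5) → ℤˣ
  | [] => ι
  | i :: p => signAt (childSign ι i) p

/-- The colour of the vertex with address `p` in a tree whose root has colour `η`. -/
def colourAt (η : Fin 2) : List (Fin 5) → Fin 2
  | [] => η
  | i :: p => colourAt (childColour η i) p

/-- A signed and coloured tree: all labels are determined by those of the root. -/
structure SignedTree where
  shape : QuinTree
  sign : ℤˣ
  colour : Fin 2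

/-! ### Couples -/

/-- Vertices of a pair of trees: the side (`0` left, `1` right) and the address. -/
abbrev Vertex : Type := Σ _ : Fin 2, List (Fin 5)

/-- The parentality order: `u` is a (non-strict) descendant of `v` in the same tree. -/
def Vertex.Below (u v : Vertex) : Prop := u.1 = v.1 ∧ v.2 <+: u.2

instance (u v : Vertex) : Decidable (u.Below v) := by unfold Vertex.Below; infer_instance

/-- The `i`-th child of a vertex. -/
def Vertex.child (v : Vertex) (i : Fin 5) : Vertex := ⟨v.1, v.2 ++ [i]⟩

/-- The sign of a vertex of a pair of trees. -/
def pairSign (T : Fin 2 → SignedTree) (v : Vertex) : ℤˣ := signAt (T v.1).sign v.2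

/-- The leaves of a pair of trees. -/
def pairLeaves (T : Fin 2 → SignedTree) : Finset Vertex :=
  Finset.univ.sigma fun s => (T s).shape.leaves

/-- A couple: a left tree `tree 0`, a right tree `tree 1`, and an involution of the set of all leaves
that exchanges leaves of sign `-` and leaves of sign `+`. -/
structure Couple where
  tree : Fin 2 → SignedTree
  pairing : pairLeaves tree → pairLeaves tree
  involutive : Function.Involutive pairing
  sign_pairing : ∀ l, pairSign tree (pairing l).1 = - pairSign tree l.1

namespace Couple

/-- The sign of a vertex of a couple. -/
def sign (C : Couple) (v : Vertex) : ℤˣ := pairSign C.tree v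

/-- The colour of a vertex of a couple. -/
def colour (C : Couple) (v : Vertex) : Fin 2 := colourAt (C.tree v.1).colour v.2

/-- The branching nodes of a couple. -/
def nodes (C : Couple) : Finset Vertex := Finset.univ.sigma fun s => (C.tree s).shape.nodes

/-- The type of branching nodes of a couple. -/
abbrev Node (C : Couple) : Type := {v : Vertex // v ∈ C.nodes}

/-- The type of leaves of a couple. -/
abbrev Leaf (C : Couple) : Type := {v : Vertex // v ∈ pairLeaves C.tree}

/-- The type of positive leaves of a couple. -/
abbrev PosLeaf (C : Couple) : Type := {l : C.Leaf // C.sign l.1 = 1}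

/-- The number of branching nodes. -/
def order (C : Couple) : ℕ := C.nodes.card

theorem sign_pairing_of_ne (C : Couple) (l : C.Leaf) (h : C.sign l.1 ≠ 1) :
    C.sign (C.pairing l).1 = 1 := by
  have h1 : C.sign l.1 = -1 := (Int.units_eq_one_or _).resolve_left h
  have h2 : C.sign (C.pairing l).1 = - C.sign l.1 := C.sign_pairing l
  rw [h2, h1, neg_neg]

/-- The wave number of a leaf, for a decoration `κ` of the positive leaves: `κ l` at a positive leaf
and `-κ (σ l)` at a negative leaf `l`. -/
def leafWave {d : ℕ} (C : Couple) (κ : C.PosLeaf → Vec d) (l : C.Leaf) : Vec d :=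
  if h : C.sign l.1 = 1 then κ ⟨l, h⟩ else - κ ⟨C.pairing l, C.sign_pairing_of_ne l h⟩

/-- The wave number `K_C(v)(κ)` of a vertex `v`: the sum over all leaves below `v` (for a leaf `v`,
this is the single term belonging to `v`). -/
def wave {d : ℕ} (C : Couple) (κ : C.PosLeaf → Vec d) (v : Vertex) : Vec d :=
  ∑ l : C.Leaf with l.1.Below v, C.leafWave κ l

/-- A node is resonant if its five children can be enumerated as `n₁, …, n₅` such that `n₁, n₂`, and
likewise `n₃, n₄`, have opposite signs and identically opposite wave numbers, and `n₅` has
identically the same wave number as the node itself. The wave numbers are compared as linear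
maps on the space of all decorations with values in `ℝ^d`. -/
def IsResonant (d : ℕ) (C : Couple) (n : Vertex) : Prop :=
  ∃ e : Equiv.Perm (Fin 5),
    ((C.sign (n.child (e 0)) : ℤ) + C.sign (n.child (e 1)) = 0) ∧
    ((C.sign (n.child (e 2)) : ℤ) + C.sign (n.child (e 3)) = 0) ∧
    (∀ κ : C.PosLeaf → Vec d, C.wave κ (n.child (e 0)) + C.wave κ (n.child (e 1)) = 0) ∧
    (∀ κ : C.PosLeaf → Vec d, C.wave κ (n.child (e 2)) + C.wave κ (n.child (e 3)) = 0) ∧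
    (∀ κ : C.PosLeaf → Vec d, C.wave κ (n.child (e 4)) = C.wave κ n)

/-- All nodes of the couple are resonant. -/
def FullyResonant (d : ℕ) (C : Couple) : Prop := ∀ n : C.Node, C.IsResonant d n.1

/-- The set `D_k(C)` of `k`-decorations: lattice-valued decorations for which the root of the left
tree has wave number `k`. -/
def decorations {d : ℕ} (C : Couple) (L : ℝ) (k : Vec d) : Set (C.PosLeaf → Vec d) :=
  {κ | (∀ l, κ l ∈ lattice d L) ∧ C.wave κ ⟨0, []⟩ = k}

/-- The resonance factor of a node. -/
def resonanceFactor {d : ℕ} (C : Couple) (κ : C.PosLeaf → Vec d) (n : Vertex) : ℝ :=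
  ((C.sign n : ℤ) : ℝ) * ‖C.wave κ n‖ ^ 2
    - ∑ i : Fin 5, ((C.sign (n.child i) : ℤ) : ℝ) * ‖C.wave κ (n.child i)‖ ^ 2

/-- The interaction coefficient `Q_n = Q^{η_n}_{ι_n}(K_C(n₁), …, K_C(n₅))` of a node `n`, where
`Q^η_+ = Q^η` and `Q^η_- = conj Q^η`. -/
def vertexFactor {d : ℕ} (Q : Fin 2 → (Fin 5 → Vec d) → ℂ) (C : Couple)
    (κ : C.PosLeaf → Vec d) (n : Vertex) : ℂ :=
  signConj (C.sign n) (Q (C.colour n) fun i => C.wave κ (n.child i))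

/-- The domain of time integration `I_C(t)`. -/
def timeDomain (C : Couple) (t : ℝ) : Set (C.Node → ℝ) :=
  {τ | (∀ n, τ n ∈ Set.Icc 0 t) ∧ ∀ n n' : C.Node, n.1.Below n'.1 → τ n ≤ τ n'}

/-- The rescaled contribution `J_C(ε⁻¹ t, k)` of a couple `C` to the correlations in a box of
size `L`. In the sum only finitely many terms are non-zero if the functions `M η η'` have bounded
support. For a couple without nodes the time integral equals `1`. -/
def amplitude {d : ℕ} (Q : Fin 2 → (Fin 5 → Vec d) → ℂ) (M : Fin 2 → Fin 2 → Vec d → ℂ)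
    (L ε : ℝ) (C : Couple) (t : ℝ) (k : Vec d) : ℂ :=
  (-Complex.I / (L : ℂ) ^ (2 * d)) ^ C.order * (∏ n : C.Node, ((C.sign n.1 : ℤ) : ℂ)) *
    ∑' κ : C.decorations L k,
      (∏ n : C.Node, C.vertexFactor Q κ.1 n.1) *
      (∫ τ in C.timeDomain t, ∏ n : C.Node,
        Complex.exp (Complex.I * ((((C.sign n.1 : ℤ) : ℝ) * ε⁻¹ *
          C.resonanceFactor κ.1 n.1 * τ n : ℝ) : ℂ))) *
      ∏ l : C.PosLeaf,
        signConj (C.sign l.1.1) (M (C.colour l.1.1) (C.colour (C.pairing l.1).1) (κ.1 l))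

end Couple

/-- The set of couples whose left and right trees have `n 0` and `n 1` nodes, root signs
`ι 0` and `ι 1`, and root colours `η 0` and `η 1`. -/
def couples (n : Fin 2 → ℕ) (ι : Fin 2 → ℤˣ) (η : Fin 2 → Fin 2) : Set Couple :=
  {C | ∀ s, (C.tree s).shape.nodes.card = n s ∧ (C.tree s).sign = ι s ∧ (C.tree s).colour = η s}

end QuinticNLS

end

namespace QuinticNLS

/-! ### Involutions and groups of leaves -/

/-! A couple with `n` branching nodes has `2n + 1` positive leaves. Fixing the wave number of the
left root removes one of these variables, so about `L ^ (2dn)` decorations lie in the support of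
`M`. This matches the prefactor `L ^ (-2dn)`, and boundedness of `Q` and `M` alone gives `O(1)`. A
power of `ε` is gained from one non-resonant node.

Put `q = ε ^ (1/4)` and split the decorations by the size of the resonance factor `Ω` of that node.
Where `|Ω| > q ^ 2`, integration in the time of that node alone gains `2 ε / |Ω| ≤ 2 q ^ 2`
(`norm_setIntegral_prod_exp_le`). The decorations with `|Ω| ≤ q ^ 2` are a fraction `O(q)` of the
total (`Couple.mul_ncard_almost_resonant_le`). They are counted along lattice lines: on a line on
which `Ω` is a quadratic polynomial with leading coefficient of modulus at least `1`, the condition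
confines the parameter to two intervals of length `O(q)`. The lattice spacing `1 / L` is at most
`ε`, because `β > 1`.

The crux is `Couple.exists_direction`: a direction that fixes the root wave number and has non-zero
leading coefficient, with bounds independent of the couple. For a direction `u • e`, with `u`
integer and antisymmetric under the pairing and `e` a unit vector, the leading coefficient is an
integer. Up to sign it is `∑ ι_i s_i ^ 2`, where `s_i` sums `u` over six groups of leaves: those
below each child of the node, and the rest. If it vanishes for all small `u`, testing with the
vectors of single pairs and polarizing shows that the pairing links each group to at most one other
group, of opposite sign (`exists_matching_of_form_eq_zero`). All six groups have odd size, and an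
involution without fixed points cannot preserve an odd set. So four children are matched in pairs,
and the node is resonant. -/

theorem even_card_of_involutive {X : Type*} {σ : X → X} (hσ : Function.Involutive σ)
    (hfix : ∀ l, σ l ≠ l) (A : Finset X) (hA : ∀ l ∈ A, σ l ∈ A) : Even A.card := by
  have h : ∑ _l ∈ A, (1 : ZMod 2) = 0 :=
    Finset.sum_involution (fun l _ => σ l) (fun _ _ => by decide) (fun l _ _ => hfix l)
      (fun l hl => hA l hl) (fun l _ => hσ l)
  rw [Finset.sum_const, nsmul_eq_mul, mul_one] at h
  exact (ZMod.natCast_eq_zero_iff_even).1 h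

theorem sum_eq_zero_of_involutive {X V : Type*} [AddCommGroup V] [Module ℝ V] {σ : X → X}
    (hσ : Function.Involutive σ) {u : X → V} (hu : ∀ l, u (σ l) = - u l) (A : Finset X)
    (hA : ∀ l ∈ A, σ l ∈ A) : ∑ l ∈ A, u l = 0 := by
  have h : ∑ l ∈ A, u l = ∑ l ∈ A, u (σ l) :=
    Finset.sum_nbij' σ σ hA hA (fun l _ => hσ l) (fun l _ => hσ l) (fun l _ => by rw [hσ l])
  simp only [hu, Finset.sum_neg_distrib] at h
  have h2 : (2 : ℝ) • ∑ l ∈ A, u l = 0 := by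
    rw [two_smul]; nth_rewrite 1 [h]; exact neg_add_cancel _
  exact (smul_eq_zero.1 h2).resolve_left two_ne_zero

/-- This evaluates the diagonal quadratic form at the group sums of a single pair of leaves lying in
different groups `a` and `b`. -/
theorem sum_mul_indicator_sq {I : Type*} [Fintype I] [DecidableEq I] (ι : I → ℤ) {a b : I}
    (hab : a ≠ b) :
    ∑ i, ι i * ((if a = i then 1 else 0) - (if b = i then 1 else 0)) ^ 2 = ι a + ι b := by
  have : ∀ i, ι i * ((if a = i then (1 : ℤ) else 0) - (if b = i then 1 else 0)) ^ 2
      = (if a = i then ι i else 0) + (if b = i then ι i else 0) := by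
    intro i; split_ifs <;> grind
  simp [this, Finset.sum_add_distrib]

/-- The polar form of two pairs that share only the group `a` sees that group alone. Its vanishing
would force `ι a = 0`, so two such pairs cannot coexist. -/
theorem sum_mul_indicator_mul {I : Type*} [Fintype I] [DecidableEq I] (ι : I → ℤ) {a b c : I}
    (hab : a ≠ b) (hac : a ≠ c) (hbc : b ≠ c) :
    ∑ i, ι i * ((if a = i then 1 else 0) - (if b = i then 1 else 0)) *
      ((if a = i then 1 else 0) - (if c = i then 1 else 0)) = ι a := by
  have : ∀ i, ι i * ((if a = i then (1 : ℤ) else 0) - (if b = i then 1 else 0)) *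
      ((if a = i then 1 else 0) - (if c = i then 1 else 0)) = (if a = i then ι i else 0) := by
    intro i; split_ifs <;> grind
  simp [this]

/-- If the quadratic form `∑ ι_i (∑_{g l = i} u l)²` vanishes for all small antisymmetric integer
functions `u` with vanishing sum over `W`, then four of the five groups `some i` are matched in pairs
that are closed under the involution `σ`. -/
theorem exists_matching_of_form_eq_zero {X : Type*} [Fintype X] [DecidableEq X] {σ : X → X}
    (hσ : Function.Involutive σ) (hfix : ∀ l, σ l ≠ l) (g : X → Option (Fin 5)) (W : Finset X)
    (hW : ∀ l ∈ W, g l = none) (hWodd : Odd W.card)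
    (hodd : ∀ i, Odd (Finset.univ.filter fun l => g l = i).card)
    (ι : Option (Fin 5) → ℤ) (hι : ∀ i, ι i ≠ 0)
    (H : ∀ u : X → ℤ, (∀ l, u (σ l) = - u l) → (∀ l, |u l| ≤ 4) → ∑ l ∈ W, u l = 0 →
      ∑ i, ι i * (∑ l with g l = i, u l) ^ 2 = 0) :
    ∃ (m : Fin 5) (p : Fin 5 → Fin 5), ∀ i, i ≠ m → p i ≠ m ∧ p i ≠ i ∧ p (p i) = i ∧
      ι (some i) + ι (some (p i)) = 0 ∧
      ∀ l, g l = some i ∨ g l = some (p i) → g (σ l) = some i ∨ g (σ l) = some (p i) := by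
  -- The pair of `e₀` crosses the boundary of `W`; multiples of its vector restore the constraint of
  -- vanishing sum over `W`.
  obtain ⟨e₀, he₀, he₀'⟩ : ∃ e ∈ W, σ e ∉ W := by
    by_contra! h
    exact (Nat.not_even_iff_odd.2 hWodd) (even_card_of_involutive hσ hfix W h)
  set i₀ := g (σ e₀) with hi₀
  -- The correction by `e₀` acts on group sums as if all leaves of `W` were moved from the group
  -- `none` into the group of `σ e₀`; see `hcK`.
  set g' : X → Option (Fin 5) := fun l => if l ∈ W then i₀ else g l with hg'
  set b : X → X → ℤ := fun l x => (if l = x then 1 else 0) - (if σ l = x then 1 else 0) with hb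
  have hbanti : ∀ l x, b l (σ x) = - b l x := by
    intro l x
    have h1 : (l = σ x) = (σ l = x) := propext ⟨fun h => by rw [h, hσ], fun h => by rw [← h, hσ]⟩
    have h2 : (σ l = σ x) = (l = x) := propext hσ.injective.eq_iff
    simp only [hb, h1, h2]; ring
  have hbabs : ∀ l x, |b l x| ≤ 1 := by
    intro l x; simp only [hb]; split_ifs <;> simp
  have hbsum : ∀ l (A : Finset X), ∑ x ∈ A, b l x
      = (if l ∈ A then 1 else 0) - (if σ l ∈ A then 1 else 0) := by
    intro l A; simp [hb, Finset.sum_sub_distrib]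
  set w : X → ℤ := fun l => (if l ∈ W then 1 else 0) - (if σ l ∈ W then 1 else 0) with hw
  have hwabs : ∀ l, |w l| ≤ 1 := by
    intro l; simp only [hw]; split_ifs <;> simp
  set c : X → X → ℤ := fun l x => b l x - w l * b e₀ x with hc
  have hcanti : ∀ l x, c l (σ x) = - c l x := by
    intro l x; simp only [hc, hbanti]; ring
  have hcabs : ∀ l x, |c l x| ≤ 2 := by
    intro l x
    have h1 := hbabs l x
    have h2 : |w l * b e₀ x| ≤ 1 := by
      rw [abs_mul]; exact mul_le_one₀ (hwabs l) (abs_nonneg _) (hbabs e₀ x)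
    exact (abs_sub _ _).trans (by linarith)
  have hcW : ∀ l, ∑ x ∈ W, c l x = 0 := by
    intro l
    simp only [hc, Finset.sum_sub_distrib, ← Finset.mul_sum, hbsum, he₀, he₀', if_true, if_false]
    simp [hw]
  set f : X → Option (Fin 5) → ℤ :=
    fun l i => (if g' l = i then 1 else 0) - (if g' (σ l) = i then 1 else 0) with hf
  have hcK : ∀ l i, ∑ x with g x = i, c l x = f l i := by
    intro l i
    simp only [hc, Finset.sum_sub_distrib, ← Finset.mul_sum, hbsum, Finset.mem_filter,
      Finset.mem_univ, true_and, hf, hg', hw, ← hi₀, hW e₀ he₀]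
    by_cases h1 : l ∈ W <;> by_cases h2 : σ l ∈ W
    · simp [h1, h2, hW l h1, hW _ h2]
    · simp [h1, h2, hW l h1]
    · simp [h1, h2, hW _ h2]
    · simp [h1, h2]
  have hQ1 : ∀ l, ∑ i, ι i * (f l i) ^ 2 = 0 := by
    intro l
    have := H (c l) (hcanti l) (fun x => (hcabs l x).trans (by norm_num)) (hcW l)
    simpa only [hcK] using this
  -- Polarization. Each `c l` is bounded by `2`, so the sum of two is bounded by `4`, the bound in
  -- `H`.
  have hQ2 : ∀ l m, ∑ i, ι i * f l i * f m i = 0 := by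
    intro l m
    have := H (fun x => c l x + c m x) (fun x => by simp only [hcanti]; ring)
      (fun x => (abs_add_le _ _).trans (by linarith [hcabs l x, hcabs m x]))
      (by simp only [Finset.sum_add_distrib, hcW, add_zero])
    simp only [Finset.sum_add_distrib, hcK] at this
    have h3 : ∑ i, ι i * (f l i + f m i) ^ 2 = ∑ i, ι i * (f l i) ^ 2 + ∑ i, ι i * (f m i) ^ 2
        + 2 * ∑ i, ι i * f l i * f m i := by
      rw [Finset.mul_sum, ← Finset.sum_add_distrib, ← Finset.sum_add_distrib]
      exact Finset.sum_congr rfl fun i _ => by ring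
    rw [this, hQ1, hQ1] at h3
    linarith
  have hsign : ∀ l, g' l ≠ g' (σ l) → ι (g' l) + ι (g' (σ l)) = 0 := by
    intro l hl
    rw [← sum_mul_indicator_sq ι hl]
    exact hQ1 l
  have huniq : ∀ l m, g' l = g' m → g' l ≠ g' (σ l) → g' m ≠ g' (σ m) → g' (σ l) = g' (σ m) := by
    intro l m hlm hl hm
    by_contra hne
    have h := sum_mul_indicator_mul ι hl (hlm ▸ hm) hne
    apply hι (g' l)
    have h2 := hQ2 l m
    simp only [hf] at h2
    rw [hlm] at h h2 ⊢
    exact h.symm.trans h2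
  -- `P` links distinct groups joined by a pair of leaves. It is a partial matching whose pairs of
  -- groups are closed under `σ`.
  set P : Option (Fin 5) → Option (Fin 5) → Prop :=
    fun i j => i ≠ j ∧ ∃ l, g' l = i ∧ g' (σ l) = j with hP
  have hPsymm : ∀ i j, P i j → P j i := by
    rintro i j ⟨hij, l, rfl, rfl⟩
    exact ⟨hij.symm, σ l, rfl, by rw [hσ]⟩
  have hPuniq : ∀ i j k, P i j → P i k → j = k := by
    rintro i j k ⟨hij, l, rfl, rfl⟩ ⟨hik, m, hm, rfl⟩
    exact huniq l m hm.symm hij (hm ▸ hik)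
  have hPsign : ∀ i j, P i j → ι i + ι j = 0 := by
    rintro i j ⟨hij, l, rfl, rfl⟩
    exact hsign l hij
  have hPclosed1 : ∀ i j, P i j → ∀ l, g' l = i → g' (σ l) = i ∨ g' (σ l) = j := by
    intro i j hij l hl
    by_cases h : g' (σ l) = i
    · exact Or.inl h
    · exact Or.inr (hPuniq i _ _ ⟨Ne.symm h, l, hl, rfl⟩ hij)
  have hPclosed : ∀ i j, P i j → ∀ l, g' l = i ∨ g' l = j → g' (σ l) = i ∨ g' (σ l) = j := by
    rintro i j hij l (hl | hl)
    · exact hPclosed1 i j hij l hl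
    · exact (hPclosed1 j i (hPsymm _ _ hij) l hl).symm
  set F : Option (Fin 5) → Finset X := fun i => Finset.univ.filter fun l => g' l = i with hF
  have hPex : ∀ i, Odd (F i).card → ∃ j, P i j := by
    intro i hi
    by_contra! h
    refine (Nat.not_even_iff_odd.2 hi) (even_card_of_involutive hσ hfix _ ?_)
    intro l hl
    simp only [hF, Finset.mem_filter, Finset.mem_univ, true_and] at hl ⊢
    by_contra hne
    exact h _ ⟨Ne.symm hne, l, hl, rfl⟩
  have hPodd : ∀ i j, P i j → Odd (F i).card → Odd (F j).card := by
    intro i j hij hi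
    have hev : Even (F i ∪ F j).card := by
      refine even_card_of_involutive hσ hfix _ ?_
      intro l hl
      simp only [hF, Finset.mem_union, Finset.mem_filter, Finset.mem_univ, true_and] at hl ⊢
      exact hPclosed i j hij l hl
    rw [Finset.card_union_of_disjoint] at hev
    · grind
    · refine Finset.disjoint_left.2 fun l h1 h2 => hij.1 ?_
      simp only [hF, Finset.mem_filter, Finset.mem_univ, true_and] at h1 h2
      rw [← h1, h2]
  have hFsame : ∀ i : Fin 5, some i ≠ i₀ → ∀ l, g' l = some i ↔ g l = some i := by
    intro i hi l
    by_cases hl : l ∈ W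
    · simp [hg', hl, hW l hl, hi.symm]
    · simp [hg', hl]
  have hFodd : ∀ i : Fin 5, some i ≠ i₀ → Odd (F (some i)).card := by
    intro i hi
    simp only [hF, hFsame i hi]
    exact hodd _
  -- If `i₀ = none`, the groups are unchanged and all six are odd, so `m` is the partner of `none`.
  -- If `i₀ = some m`, moving the odd set `W` makes the groups `none` and `m` even, so the other
  -- four are matched among themselves.
  have key : ∃ m : Fin 5, ∀ i, i ≠ m → some i ≠ i₀ ∧ ∃ j, j ≠ m ∧ P (some i) (some j) := by
    rcases hcase : i₀ with _ | m
    · have hsame : g' = g := by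
        funext l
        by_cases hl : l ∈ W
        · simp [hg', hl, hW l hl, hcase]
        · simp [hg', hl]
      obtain ⟨j, hj⟩ := hPex none (by simp only [hF, hsame]; exact hodd _)
      obtain _ | m := j
      · exact absurd rfl hj.1
      refine ⟨m, fun i hi => ⟨by simp, ?_⟩⟩
      obtain ⟨j, hj'⟩ := hPex (some i) (hFodd i (by simp [hcase]))
      obtain _ | j := j
      · exact absurd (Option.some_injective _ (hPuniq _ _ _ hj (hPsymm _ _ hj'))) hi.symm
      · refine ⟨j, ?_, hj'⟩
        rintro rfl
        exact absurd (hPuniq _ _ _ (hPsymm _ _ hj) (hPsymm _ _ hj')) (by simp)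
    · have hWF : W ⊆ Finset.univ.filter fun l => g l = none := by
        intro l hl; simp [hW l hl]
      have hnone : ¬ Odd (F none).card := by
        have h1 : F none = (Finset.univ.filter fun l => g l = none) \ W := by
          ext l
          by_cases hl : l ∈ W
          · simp [hF, hg', hl, hcase]
          · simp [hF, hg', hl]
        have h2 := Finset.card_sdiff_add_card_eq_card hWF
        have h3 := hodd none
        rw [h1]
        grind
      have hm : ¬ Odd (F (some m)).card := by
        have h1 : F (some m) = (Finset.univ.filter fun l => g l = some m) ∪ W := by
          ext l
          by_cases hl : l ∈ W
          · simp [hF, hg', hl, hcase]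
          · simp [hF, hg', hl]
        rw [h1, Finset.card_union_of_disjoint]
        · have h3 := hodd (some m)
          grind
        · refine Finset.disjoint_left.2 fun l h1 h2 => ?_
          simp [hW l h2] at h1
      refine ⟨m, fun i hi => ?_⟩
      have hi' : some i ≠ i₀ := by rw [hcase]; simpa using hi
      refine ⟨by simpa [hcase] using hi', ?_⟩
      obtain ⟨j, hj'⟩ := hPex (some i) (hFodd i hi')
      have hjo := hPodd _ _ hj' (hFodd i hi')
      obtain _ | j := j
      · exact absurd hjo hnone
      · refine ⟨j, ?_, hj'⟩
        rintro rfl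
        exact hm hjo
  obtain ⟨m, hm⟩ := key
  choose h₀ p hp using hm
  refine ⟨m, fun i => if h : i = m then m else p i h, fun i hi => ?_⟩
  have hpi := (hp i hi).1
  have hPi := (hp i hi).2
  simp only [hi, dif_neg, not_false_eq_true, hpi]
  refine ⟨hpi, ?_, ?_, hPsign _ _ hPi, ?_⟩
  · intro h
    exact hPi.1 (by rw [h])
  · exact Option.some_injective _ (hPuniq _ _ _ (hp _ hpi).2 (hPsymm _ _ hPi))
  · intro l hl
    have := hPclosed _ _ hPi l
    rw [hFsame i (h₀ i hi), hFsame _ (h₀ _ hpi), hFsame i (h₀ i hi), hFsame _ (h₀ _ hpi)] at this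
    exact this hl

/-- A fixed-point free matching of the complement of one point of `Fin 5` is realized by an
enumeration. -/
theorem exists_perm_of_matching {m : Fin 5} {p : Fin 5 → Fin 5}
    (h : ∀ i, i ≠ m → p i ≠ m ∧ p i ≠ i ∧ p (p i) = i) :
    ∃ e : Equiv.Perm (Fin 5), e 4 = m ∧ e 0 ≠ m ∧ e 2 ≠ m ∧ e 1 = p (e 0) ∧ e 3 = p (e 2) := by
  obtain ⟨a, ha⟩ : ∃ a, a ≠ m := exists_ne m
  obtain ⟨c, hc⟩ : ∃ c, c ∉ ({m, a, p a} : Finset (Fin 5)) := by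
    by_contra! hall
    have h1 : (Finset.univ : Finset (Fin 5)) ⊆ {m, a, p a} := fun x _ => hall x
    have h2 := (Finset.card_le_card h1).trans Finset.card_le_three
    simp at h2
  simp only [Finset.mem_insert, Finset.mem_singleton, not_or] at hc
  obtain ⟨hcm, hca, hcp⟩ := hc
  obtain ⟨h1, h2, h3⟩ := h a ha
  obtain ⟨h4, h5, h6⟩ := h c hcm
  have h7 : p c ≠ a := fun h' => hcp (by rw [← h', h6])
  have h8 : p c ≠ p a := fun h' => hca (by rw [← h6, h', h3])
  have hinj : Function.Injective ![a, p a, c, p c, m] := by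
    intro x y hxy
    fin_cases x <;> fin_cases y <;> first | rfl | (exfalso; simp at hxy; grind)
  refine ⟨Equiv.ofBijective _ (Finite.injective_iff_bijective.1 hinj), ?_⟩
  simp [Equiv.ofBijective_apply, ha, hcm]


/-! ### Leaves of trees -/

theorem card_biUnion_image_cons (F : Fin 5 → Finset (List (Fin 5))) :
    (Finset.univ.biUnion fun i => (F i).image (List.cons i)).card = ∑ i, (F i).card := by
  rw [Finset.card_biUnion]
  · exact Finset.sum_congr rfl fun i _ => Finset.card_image_of_injective _ List.cons_injective
  · intro i _ j _ hij
    refine Finset.disjoint_left.2 fun l h1 h2 => hij ?_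
    simp only [Finset.mem_image] at h1 h2
    obtain ⟨a, -, rfl⟩ := h1
    obtain ⟨b, -, h⟩ := h2
    exact (List.cons.inj h).1.symm

theorem QuinTree.card_leaves (T : QuinTree) : T.leaves.card = 4 * T.nodes.card + 1 := by
  induction T with
  | leaf => rfl
  | node c ih =>
    rw [QuinTree.leaves, QuinTree.nodes, card_biUnion_image_cons, Finset.card_insert_of_notMem,
      card_biUnion_image_cons]
    · simp only [ih, Finset.sum_add_distrib, ← Finset.mul_sum]
      simp; ring
    · simp

/-- The subtree at a child has `4k + 1` leaves, where `k` is its number of nodes; the induction only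
strips the common address. -/
theorem QuinTree.odd_card_leaves_below (T : QuinTree) {p : List (Fin 5)} (hp : p ∈ T.nodes)
    (i : Fin 5) : Odd (T.leaves.filter fun q => p ++ [i] <+: q).card := by
  induction T generalizing p with
  | leaf => simp [QuinTree.nodes] at hp
  | node c ih =>
    have hcons : ∀ (j : Fin 5) (r : List (Fin 5)),
        ((QuinTree.node c).leaves.filter fun q => j :: r <+: q)
          = ((c j).leaves.filter fun q => r <+: q).image (List.cons j) := by
      intro j r
      ext q
      simp only [QuinTree.leaves, Finset.mem_filter, Finset.mem_biUnion, Finset.mem_univ, true_and,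
        Finset.mem_image]
      constructor
      · rintro ⟨⟨k, a, ha, rfl⟩, hpre⟩
        rw [List.cons_prefix_cons] at hpre
        obtain ⟨rfl, hpre⟩ := hpre
        exact ⟨a, ⟨ha, hpre⟩, rfl⟩
      · rintro ⟨a, ⟨ha, hpre⟩, rfl⟩
        exact ⟨⟨j, a, ha, rfl⟩, List.cons_prefix_cons.2 ⟨rfl, hpre⟩⟩
    simp only [QuinTree.nodes, Finset.mem_insert, Finset.mem_biUnion, Finset.mem_univ, true_and,
      Finset.mem_image] at hp
    rcases hp with rfl | ⟨j, r, hr, rfl⟩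
    · rw [List.nil_append, hcons, Finset.card_image_of_injective _ List.cons_injective]
      simp only [List.nil_prefix, Finset.filter_true, QuinTree.card_leaves]
      exact ⟨2 * (c i).nodes.card, by ring⟩
    · rw [List.cons_append, hcons, Finset.card_image_of_injective _ List.cons_injective]
      exact ih j hr

theorem QuinTree.exists_child_prefix (T : QuinTree) {p q : List (Fin 5)} (hp : p ∈ T.nodes)
    (hq : q ∈ T.leaves) (hpq : p <+: q) : ∃ i, p ++ [i] <+: q := by
  induction T generalizing p q with
  | leaf => simp [QuinTree.nodes] at hp
  | node c ih =>
    simp only [QuinTree.leaves, Finset.mem_biUnion, Finset.mem_univ, true_and,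
      Finset.mem_image] at hq
    simp only [QuinTree.nodes, Finset.mem_insert, Finset.mem_biUnion, Finset.mem_univ, true_and,
      Finset.mem_image] at hp
    obtain ⟨k, a, ha, rfl⟩ := hq
    rcases hp with rfl | ⟨j, r, hr, rfl⟩
    · exact ⟨k, by simp⟩
    · rw [List.cons_prefix_cons] at hpq
      obtain ⟨rfl, hpre⟩ := hpq
      obtain ⟨i, hi⟩ := ih j hr ha hpre
      exact ⟨i, by rw [List.cons_append]; exact List.cons_prefix_cons.2 ⟨rfl, hi⟩⟩

/-! ### Leaf counts and groups of leaves in a couple -/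

namespace Couple

variable (C : Couple)

theorem pairing_ne (l : C.Leaf) : C.pairing l ≠ l := by
  intro h
  have := C.sign_pairing l
  rw [h] at this
  exact (units_ne_neg_self _) this

theorem card_nodes_eq : C.order = ∑ s, (C.tree s).shape.nodes.card := by
  simp [order, nodes, Finset.card_sigma]

theorem card_leaf_filter (P : Vertex → Prop) [DecidablePred P] :
    (Finset.univ.filter fun l : C.Leaf => P l.1).card = ((pairLeaves C.tree).filter P).card := by
  rw [← Finset.card_map (Function.Embedding.subtype _)]
  congr 1
  ext v
  simp only [Finset.mem_map, Finset.mem_filter, Finset.mem_univ, true_and,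
    Function.Embedding.subtype_apply]
  exact ⟨fun ⟨a, h, hv⟩ => hv ▸ ⟨a.2, h⟩, fun h => ⟨⟨v, h.1⟩, h.2, rfl⟩⟩

theorem card_leaf : Fintype.card C.Leaf = 4 * C.order + 2 := by
  rw [Fintype.card_coe, pairLeaves, Finset.card_sigma, card_nodes_eq]
  simp [QuinTree.card_leaves]
  ring

theorem card_leaf_sigma (s : Fin 2) (P : List (Fin 5) → Prop) [DecidablePred P] :
    (Finset.univ.filter fun l : C.Leaf => l.1.1 = s ∧ P l.1.2).card
      = ((C.tree s).shape.leaves.filter P).card := by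
  rw [C.card_leaf_filter fun v => v.1 = s ∧ P v.2,
    ← Finset.card_map (Function.Embedding.sigmaMk (β := fun _ : Fin 2 => List (Fin 5)) s)]
  congr 1
  ext ⟨a, q⟩
  simp only [pairLeaves, Finset.mem_filter, Finset.mem_sigma, Finset.mem_univ, true_and,
    Finset.mem_map, Function.Embedding.sigmaMk_apply]
  constructor
  · rintro ⟨h1, rfl, h2⟩
    exact ⟨q, ⟨h1, h2⟩, rfl⟩
  · rintro ⟨q', ⟨h1, h2⟩, h⟩
    cases h
    exact ⟨h1, rfl, h2⟩

theorem odd_card_side (s : Fin 2) : Odd (Finset.univ.filter fun l : C.Leaf => l.1.1 = s).card := by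
  have := C.card_leaf_sigma s fun _ => True
  simp only [and_true, Finset.filter_true] at this
  rw [this, QuinTree.card_leaves]
  exact ⟨2 * (C.tree s).shape.nodes.card, by ring⟩

theorem mem_nodes_iff {v : Vertex} : v ∈ C.nodes ↔ v.2 ∈ (C.tree v.1).shape.nodes := by
  simp [nodes]

theorem mem_leaves (l : C.Leaf) : l.1.2 ∈ (C.tree l.1.1).shape.leaves := by
  have := l.2
  simp only [pairLeaves, Finset.mem_sigma] at this
  exact this.2

theorem odd_card_below_child {n : Vertex} (hn : n ∈ C.nodes) (i : Fin 5) :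
    Odd (Finset.univ.filter fun l : C.Leaf => l.1.Below (n.child i)).card := by
  have h := C.card_leaf_sigma n.1 fun q => n.2 ++ [i] <+: q
  have h2 := (C.tree n.1).shape.odd_card_leaves_below (C.mem_nodes_iff.1 hn) i
  rw [← h] at h2
  exact h2

theorem below_of_below_child {u n : Vertex} {i : Fin 5} (h : u.Below (n.child i)) : u.Below n :=
  ⟨h.1, (List.prefix_append _ _).trans h.2⟩

theorem exists_below_child {n : Vertex} (hn : n ∈ C.nodes) {l : C.Leaf} (h : l.1.Below n) :
    ∃ i, l.1.Below (n.child i) := by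
  obtain ⟨h1, h2⟩ := h
  have hl := C.mem_leaves l
  rw [h1] at hl
  obtain ⟨i, hi⟩ := (C.tree n.1).shape.exists_child_prefix (C.mem_nodes_iff.1 hn) hl h2
  exact ⟨i, h1, hi⟩

theorem below_child_unique {u n : Vertex} {i j : Fin 5} (hi : u.Below (n.child i))
    (hj : u.Below (n.child j)) : i = j := by
  have h := List.prefix_of_prefix_length_le hi.2 hj.2 (by simp [Vertex.child])
  have h' := List.IsPrefix.eq_of_length h (by simp [Vertex.child])
  simpa [Vertex.child] using h'

open Classical in
/-- The index of the child of `n` above the leaf `l`, or `none` if `l` is not below `n`. -/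
noncomputable def childIndex (n : Vertex) (l : C.Leaf) : Option (Fin 5) :=
  if h : ∃ i, l.1.Below (n.child i) then some h.choose else none

theorem childIndex_eq_some {n : Vertex} {l : C.Leaf} {i : Fin 5} :
    C.childIndex n l = some i ↔ l.1.Below (n.child i) := by
  unfold childIndex
  split_ifs with h
  · rw [Option.some_inj]
    exact ⟨fun h' => h' ▸ h.choose_spec, fun h' => below_child_unique h.choose_spec h'⟩
  · simp only [false_iff]
    exact fun h' => h ⟨i, h'⟩

theorem childIndex_eq_none {n : Vertex} (hn : n ∈ C.nodes) {l : C.Leaf} :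
    C.childIndex n l = none ↔ ¬ l.1.Below n := by
  unfold childIndex
  split_ifs with h
  · simp only [false_iff, not_not]
    exact below_of_below_child h.choose_spec
  · simp only [true_iff]
    exact fun h' => h (C.exists_below_child hn h')

/-! ### Wave numbers -/

variable {d : ℕ}

theorem leafWave_pairing (κ : C.PosLeaf → Vec d) (l : C.Leaf) :
    C.leafWave κ (C.pairing l) = - C.leafWave κ l := by
  have hs : C.sign (C.pairing l).1 = - C.sign l.1 := C.sign_pairing l
  unfold leafWave
  rcases Int.units_eq_one_or (C.sign l.1) with h | h
  · have h' : ¬ C.sign (C.pairing l).1 = 1 := by rw [hs, h]; decide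
    simp [h, h', C.involutive l]
  · have h' : C.sign (C.pairing l).1 = 1 := by rw [hs, h]; rfl
    have h'' : ¬ C.sign l.1 = 1 := by rw [h]; decide
    simp [h', h'']

theorem leafWave_add_smul (κ V : C.PosLeaf → Vec d) (x : ℝ) (l : C.Leaf) :
    C.leafWave (fun l => κ l + x • V l) l = C.leafWave κ l + x • C.leafWave V l := by
  unfold leafWave
  split_ifs
  · rfl
  · rw [smul_neg, neg_add]

theorem wave_add_smul (κ V : C.PosLeaf → Vec d) (x : ℝ) (v : Vertex) :
    C.wave (fun l => κ l + x • V l) v = C.wave κ v + x • C.wave V v := by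
  simp only [wave, leafWave_add_smul, Finset.sum_add_distrib, Finset.smul_sum]

/-- The part of the resonance factor that is linear along a line. -/
theorem exists_resonanceFactor_line (κ V : C.PosLeaf → Vec d) (n : Vertex) :
    ∃ b : ℝ, ∀ x : ℝ, C.resonanceFactor (fun l => κ l + x • V l) n
      = C.resonanceFactor V n * x ^ 2 + b * x + C.resonanceFactor κ n := by
  refine ⟨((C.sign n : ℤ) : ℝ) * (2 * inner ℝ (C.wave κ n) (C.wave V n))
    - ∑ i : Fin 5, ((C.sign (n.child i) : ℤ) : ℝ) *
      (2 * inner ℝ (C.wave κ (n.child i)) (C.wave V (n.child i))), fun x => ?_⟩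
  have h : ∀ v, ‖C.wave (fun l => κ l + x • V l) v‖ ^ 2 = ‖C.wave V v‖ ^ 2 * x ^ 2
      + 2 * inner ℝ (C.wave κ v) (C.wave V v) * x + ‖C.wave κ v‖ ^ 2 := by
    intro v
    rw [wave_add_smul, norm_add_sq_real, norm_smul, inner_smul_right, mul_pow, Real.norm_eq_abs,
      sq_abs]
    ring
  simp only [resonanceFactor, h, mul_add, Finset.sum_add_distrib, sub_mul, Finset.sum_mul]
  simp only [← mul_assoc]
  ring

theorem wave_eq_sum_child (κ : C.PosLeaf → Vec d) {n : Vertex} (hn : n ∈ C.nodes) :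
    C.wave κ n = ∑ i, C.wave κ (n.child i) := by
  simp only [wave, Finset.sum_filter]
  rw [Finset.sum_comm]
  refine Finset.sum_congr rfl fun l _ => ?_
  by_cases h : l.1.Below n
  · obtain ⟨i, hi⟩ := C.exists_below_child hn h
    rw [Finset.sum_eq_single i]
    · simp [h, hi]
    · intro j _ hj
      rw [if_neg]
      exact fun h' => hj (below_child_unique h' hi)
    · simp
  · rw [if_neg h]
    symm
    refine Finset.sum_eq_zero fun i _ => if_neg ?_
    exact fun h' => h (below_of_below_child h')


/-! ### Antisymmetric integer directions and resonance -/

theorem leafWave_of_antisymm {u : C.Leaf → ℤ} (hu : ∀ l, u (C.pairing l) = - u l) (v : Vec d)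
    (l : C.Leaf) : C.leafWave (fun l => (u l.1 : ℝ) • v) l = (u l : ℝ) • v := by
  unfold leafWave
  split_ifs
  · rfl
  · simp [hu]

theorem wave_of_antisymm {u : C.Leaf → ℤ} (hu : ∀ l, u (C.pairing l) = - u l) (e : Vec d)
    (v : Vertex) : C.wave (fun l => (u l.1 : ℝ) • e) v
      = ((∑ l : C.Leaf with l.1.Below v, u l : ℤ) : ℝ) • e := by
  simp only [wave, C.leafWave_of_antisymm hu, Int.cast_sum, Finset.sum_smul]

theorem below_root {u : Vertex} {s : Fin 2} : u.Below ⟨s, []⟩ ↔ u.1 = s := by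
  simp [Vertex.Below]

theorem sum_antisymm_eq_zero {u : C.Leaf → ℤ} (hu : ∀ l, u (C.pairing l) = - u l) :
    ∑ l, u l = 0 := by
  have := sum_eq_zero_of_involutive C.involutive (u := fun l => (u l : ℝ))
    (fun l => by simp [hu]) Finset.univ fun _ _ => Finset.mem_univ _
  exact_mod_cast this

theorem sum_side_add_sum_side (u : C.Leaf → ℤ) :
    (∑ l : C.Leaf with l.1.1 = 0, u l) + ∑ l : C.Leaf with l.1.1 = 1, u l = ∑ l, u l := by
  rw [← Finset.sum_filter_add_sum_filter_not Finset.univ (fun l : C.Leaf => l.1.1 = 0)]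
  congr 1
  refine Finset.sum_congr (Finset.filter_congr fun l _ => ?_) fun _ _ => rfl
  generalize l.1.1 = a
  revert a
  decide

theorem odd_card_childIndex {n : Vertex} (hn : n ∈ C.nodes) (i : Option (Fin 5)) :
    Odd (Finset.univ.filter fun l => C.childIndex n l = i).card := by
  have hsome : ∀ i, Odd (Finset.univ.filter fun l => C.childIndex n l = some i).card := by
    intro i
    simp only [childIndex_eq_some]
    exact C.odd_card_below_child hn i
  obtain _ | i := i
  -- The leaves number `4 * C.order + 2`, an even number; removing five odd groups leaves an odd
  -- one.
  · have h := Finset.card_eq_sum_card_fiberwise (f := C.childIndex n) (s := Finset.univ)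
      (t := Finset.univ) fun _ _ => Finset.mem_coe.2 (Finset.mem_univ _)
    rw [Finset.card_univ, card_leaf, Fintype.sum_option, Fin.sum_univ_five] at h
    obtain ⟨a0, h0⟩ := hsome 0
    obtain ⟨a1, h1⟩ := hsome 1
    obtain ⟨a2, h2⟩ := hsome 2
    obtain ⟨a3, h3⟩ := hsome 3
    obtain ⟨a4, h4⟩ := hsome 4
    rw [h0, h1, h2, h3, h4] at h
    refine ⟨2 * C.order + 1 - (a0 + a1 + a2 + a3 + a4) - 3, ?_⟩
    omega
  · exact hsome i

/-- The signs of the six groups of leaves at a node: those below the children and the others. -/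
def groupSign (n : Vertex) : Option (Fin 5) → ℤ
  | none => - (C.sign n : ℤ)
  | some i => (C.sign (n.child i) : ℤ)

theorem wave_child_add_eq_zero {n : Vertex} {i j : Fin 5} (hij : i ≠ j)
    (h : ∀ l, C.childIndex n l = some i ∨ C.childIndex n l = some j →
      C.childIndex n (C.pairing l) = some i ∨ C.childIndex n (C.pairing l) = some j)
    (κ : C.PosLeaf → Vec d) : C.wave κ (n.child i) + C.wave κ (n.child j) = 0 := by
  unfold wave
  rw [← Finset.sum_union]
  · refine sum_eq_zero_of_involutive C.involutive (C.leafWave_pairing κ) _ ?_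
    intro l hl
    simp only [Finset.mem_union, Finset.mem_filter, Finset.mem_univ, true_and,
      ← childIndex_eq_some] at hl ⊢
    exact h l hl
  · refine Finset.disjoint_left.2 fun l h1 h2 => hij ?_
    simp only [Finset.mem_filter, Finset.mem_univ, true_and] at h1 h2
    exact below_child_unique h1 h2

/-- At a non-resonant node, the resonance factor is a non-degenerate quadratic function along some
bounded integer direction that does not change the wave number of the root. -/
theorem exists_direction {n : Vertex} (hn : n ∈ C.nodes) (hres : ¬ C.IsResonant d n) (i₀ : Fin d) :
    ∃ V : C.PosLeaf → Vec d,
      (∀ l, ∃ z : ℤ, |z| ≤ 4 ∧ V l = (z : ℝ) • EuclideanSpace.single i₀ (1 : ℝ)) ∧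
      C.wave V ⟨0, []⟩ = 0 ∧ 1 ≤ |C.resonanceFactor V n| := by
  by_contra! hV
  apply hres
  set e : Vec d := EuclideanSpace.single i₀ (1 : ℝ) with he
  have hnorm : ‖e‖ = 1 := by simp [he]
  have hother : ∀ a b : Fin 2, a = 1 - b → a ≠ b := by decide
  -- Here `W` is the set of leaves of the tree that does not contain `n`.
  obtain ⟨m, p, hp⟩ := exists_matching_of_form_eq_zero C.involutive C.pairing_ne
    (C.childIndex n) (Finset.univ.filter fun l => l.1.1 = 1 - n.1)
    (fun l hl => (C.childIndex_eq_none hn).2 fun h =>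
      hother _ _ (Finset.mem_filter.1 hl).2 h.1)
    (C.odd_card_side _) (C.odd_card_childIndex hn) (C.groupSign n)
    (by rintro (_ | i) <;> simp [groupSign]) (by
    intro u hu hu4 huW
    -- The total sum of `u` vanishes, so its sum over either tree vanishes as soon as the other
    -- does, whichever tree contains `n`.
    have hroot : ∑ l : C.Leaf with l.1.1 = 0, u l = 0 := by
      have h1 := C.sum_side_add_sum_side u
      rw [C.sum_antisymm_eq_zero hu] at h1
      have hcase : ∀ a : Fin 2, a = 0 ∨ a = 1 := by decide
      rcases hcase n.1 with h | h
      · simp only [h, sub_zero] at huW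
        rw [huW, add_zero] at h1
        exact h1
      · simpa only [h, sub_self] using huW
    have h := hV (fun l => (u l.1 : ℝ) • e) (fun l => ⟨u l.1, hu4 _, rfl⟩) (by
      rw [C.wave_of_antisymm hu]
      simp only [below_root, hroot, Int.cast_zero, zero_smul])
    have hwn : ∀ v, ‖C.wave (fun l => (u l.1 : ℝ) • e) v‖ ^ 2
        = (((∑ l : C.Leaf with l.1.Below v, u l) ^ 2 : ℤ) : ℝ) := by
      intro v
      rw [C.wave_of_antisymm hu, norm_smul, hnorm, mul_one, Real.norm_eq_abs, sq_abs, Int.cast_pow]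
    simp only [resonanceFactor, hwn] at h
    norm_cast at h
    -- Integrality turns modulus less than `1` into zero; conversely it gives the uniform lower
    -- bound `1`.
    rw [Int.abs_lt_one_iff] at h
    have hnone : ∑ l with C.childIndex n l = none, u l = - ∑ l : C.Leaf with l.1.Below n, u l := by
      simp only [C.childIndex_eq_none hn]
      rw [eq_neg_iff_add_eq_zero, add_comm, Finset.sum_filter_add_sum_filter_not]
      exact C.sum_antisymm_eq_zero hu
    rw [Fintype.sum_option, hnone]
    simp only [childIndex_eq_some, groupSign]
    linarith [h])
  obtain ⟨σ, h4, h0, h2, h1, h3⟩ := exists_perm_of_matching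
    fun i hi => ⟨(hp i hi).1, (hp i hi).2.1, (hp i hi).2.2.1⟩
  have hw : ∀ i, i ≠ m → ∀ κ : C.PosLeaf → Vec d,
      C.wave κ (n.child i) + C.wave κ (n.child (p i)) = 0 := fun i hi κ =>
    C.wave_child_add_eq_zero (hp i hi).2.1.symm (hp i hi).2.2.2.2 κ
  have h01 := hw _ h0
  have h23 := hw _ h2
  rw [← h1] at h01
  rw [← h3] at h23
  refine ⟨σ, ?_, ?_, h01, h23, fun κ => ?_⟩
  · rw [h1]; exact (hp _ h0).2.2.2.1
  · rw [h3]; exact (hp _ h2).2.2.2.1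
  · rw [C.wave_eq_sum_child κ hn, ← Equiv.sum_comp σ, Fin.sum_univ_five, h01 κ, zero_add,
      h23 κ, zero_add]

end Couple

/-! ### Counting lattice points -/

theorem card_le_of_diam_le {A : Finset ℕ} {D : ℝ} (hD : 0 ≤ D)
    (h : ∀ x ∈ A, ∀ y ∈ A, (x : ℝ) - y ≤ D) : (A.card : ℝ) ≤ D + 1 := by
  rcases A.eq_empty_or_nonempty with rfl | hne
  · simpa using by linarith
  · have hsub : A ⊆ Finset.Icc (A.min' hne) (A.min' hne + ⌊D⌋₊) := by
      intro x hx
      have h1 := h x hx _ (A.min'_mem hne)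
      have h2 := A.min'_le x hx
      rw [Finset.mem_Icc]
      refine ⟨h2, ?_⟩
      have h3 : ((x - A.min' hne : ℕ) : ℝ) ≤ D := by rwa [Nat.cast_sub h2]
      have := Nat.le_floor h3
      omega
    have h1 := Finset.card_le_card hsub
    rw [Nat.card_Icc] at h1
    have h2 := Nat.floor_le hD
    have h3 : A.card ≤ ⌊D⌋₊ + 1 := by omega
    have h4 : (A.card : ℝ) ≤ ⌊D⌋₊ + 1 := by exact_mod_cast h3
    linarith

/-- On one side of the vertex `p`, `(x - y) ^ 2` is at most `|(x - p) ^ 2 - (y - p) ^ 2|`, which is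
at most `2 * μ`. -/
theorem sub_le_sqrt_of_quadratic {a p q μ x y : ℝ} (ha : 1 ≤ |a|)
    (hx : |a * (x - p) ^ 2 + q| ≤ μ) (hy : |a * (y - p) ^ 2 + q| ≤ μ)
    (h : 0 ≤ (x - p) * (y - p)) : x - y ≤ √(2 * μ) := by
  apply Real.le_sqrt_of_sq_le
  have h1 : |a * ((x - p) ^ 2 - (y - p) ^ 2)| ≤ 2 * μ := by
    have := abs_sub (a * (x - p) ^ 2 + q) (a * (y - p) ^ 2 + q)
    calc _ = |a * (x - p) ^ 2 + q - (a * (y - p) ^ 2 + q)| := by congr 1; ring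
      _ ≤ _ := by linarith
  have h2 : |(x - p) ^ 2 - (y - p) ^ 2| ≤ 2 * μ := by
    rw [abs_mul] at h1
    exact (le_mul_of_one_le_left (abs_nonneg _) ha).trans h1
  rcases le_total ((x - p) ^ 2) ((y - p) ^ 2) with h3 | h3
  · rw [abs_of_nonpos (by linarith)] at h2
    have : |x - p| ≤ |y - p| := sq_le_sq.1 h3
    have h4 : (x - p) ^ 2 ≤ (x - p) * (y - p) := by
      rw [← abs_of_nonneg h, abs_mul, ← sq_abs, sq]
      exact mul_le_mul_of_nonneg_left this (abs_nonneg _)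
    nlinarith
  · rw [abs_of_nonneg (by linarith)] at h2
    have : |y - p| ≤ |x - p| := sq_le_sq.1 h3
    have h4 : (y - p) ^ 2 ≤ (x - p) * (y - p) := by
      rw [← abs_of_nonneg h, abs_mul, ← sq_abs, sq]
      exact mul_le_mul_of_nonneg_right this (abs_nonneg _)
    nlinarith

/-- The two sides of the vertex account for the factor `2`. The bound is uniform in `b` and `c`,
which vary with the base point of the line. -/
theorem card_quadratic_le {a b c μ L : ℝ} (ha : 1 ≤ |a|) (hL : 0 < L) (N : ℕ) :
    (((Finset.range N).filter fun j : ℕ => |a * (j / L) ^ 2 + b * (j / L) + c| ≤ μ).card : ℝ)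
      ≤ 2 * (L * √(2 * μ) + 1) := by
  set A := (Finset.range N).filter fun j : ℕ => |a * (j / L) ^ 2 + b * (j / L) + c| ≤ μ with hA
  have ha0 : a ≠ 0 := by rintro rfl; norm_num at ha
  set p := - b / (2 * a) with hp
  set q := c - a * p ^ 2 with hq
  have hAq : ∀ j ∈ A, |a * ((j : ℝ) / L - p) ^ 2 + q| ≤ μ := by
    intro j hj
    have h1 := (Finset.mem_filter.1 hj).2
    have h2 : a * ((j : ℝ) / L - p) ^ 2 + q = a * (j / L) ^ 2 + b * (j / L) + c := by
      rw [hq, hp]; field_simp; ring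
    rwa [h2]
  have hD : 0 ≤ L * √(2 * μ) := mul_nonneg hL.le (Real.sqrt_nonneg _)
  have hdiff : ∀ x ∈ A, ∀ y ∈ A, 0 ≤ ((x : ℝ) / L - p) * ((y : ℝ) / L - p) →
      (x : ℝ) - y ≤ L * √(2 * μ) := by
    intro x hx y hy hxy
    have := sub_le_sqrt_of_quadratic ha (hAq x hx) (hAq y hy) hxy
    rw [← sub_div, div_le_iff₀ hL] at this
    linarith
  rw [← Finset.card_filter_add_card_filter_not (s := A) (fun j : ℕ => p ≤ (j : ℝ) / L),
    Nat.cast_add]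
  have h1 : ((A.filter fun j : ℕ => p ≤ (j : ℝ) / L).card : ℝ) ≤ L * √(2 * μ) + 1 := by
    refine card_le_of_diam_le hD fun x hx y hy => ?_
    rw [Finset.mem_filter] at hx hy
    exact hdiff x hx.1 y hy.1 (mul_nonneg (by linarith) (by linarith))
  have h2 : ((A.filter fun j : ℕ => ¬ p ≤ (j : ℝ) / L).card : ℝ) ≤ L * √(2 * μ) + 1 := by
    refine card_le_of_diam_le hD fun x hx y hy => ?_
    rw [Finset.mem_filter] at hx hy
    exact hdiff x hx.1 y hy.1 (mul_nonneg_of_nonpos_of_nonpos (by linarith) (by linarith))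
  linarith

theorem exists_finset_lattice_ball (d : ℕ) {L r : ℝ} (hL : 1 ≤ L) (hr : 0 ≤ r) :
    ∃ B : Finset (Vec d), (∀ x ∈ lattice d L, ‖x‖ ≤ r → x ∈ B) ∧
      (B.card : ℝ) ≤ ((2 * r + 1) * L) ^ d := by
  classical
  have hL0 : 0 < L := by linarith
  set N : ℕ := ⌊r * L⌋₊ with hN
  refine ⟨(Fintype.piFinset fun _ : Fin d => Finset.Icc (-(N : ℤ)) N).image
    fun m => WithLp.toLp 2 fun i => (m i : ℝ) / L, ?_, ?_⟩
  · rintro x ⟨m, hm⟩ hx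
    refine Finset.mem_image.2 ⟨m, ?_, ?_⟩
    · rw [Fintype.mem_piFinset]
      intro i
      have h1 : ‖x i‖ ≤ r := (PiLp.norm_apply_le x i).trans hx
      rw [hm i, Real.norm_eq_abs, abs_div, abs_of_pos hL0, div_le_iff₀ hL0] at h1
      have h2 : ((m i).natAbs : ℝ) ≤ r * L := by
        rwa [Nat.cast_natAbs, Int.cast_abs]
      have h3 := Nat.le_floor h2
      rw [Finset.mem_Icc]
      omega
    · ext i
      simp [hm i]
  · refine (Nat.cast_le.2 Finset.card_image_le).trans ?_
    rw [Fintype.card_piFinset]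
    simp only [Int.card_Icc, Finset.prod_const, Finset.card_univ, Fintype.card_fin]
    push_cast
    refine pow_le_pow_left₀ (by positivity) ?_ d
    have h1 : (((N : ℤ) + 1 - -(N : ℤ)).toNat : ℝ) = 2 * N + 1 := by
      have : ((N : ℤ) + 1 - -(N : ℤ)).toNat = 2 * N + 1 := by omega
      rw [this]; push_cast; ring
    rw [h1]
    have h2 : (N : ℝ) ≤ r * L := Nat.floor_le (by positivity)
    linarith

/-! ### Counting decorations -/

namespace Couple

variable (C : Couple) {d : ℕ}

theorem card_posLeaf : Fintype.card C.PosLeaf = 2 * C.order + 1 := by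
  have h1 : (Finset.univ.filter fun l : C.Leaf => C.sign l.1 = 1).card
      = (Finset.univ.filter fun l : C.Leaf => ¬ C.sign l.1 = 1).card := by
    refine Finset.card_bij' (fun l _ => C.pairing l) (fun l _ => C.pairing l) ?_ ?_
      (fun l _ => C.involutive l) (fun l _ => C.involutive l)
    · intro l hl
      have hs : C.sign (C.pairing l).1 = - C.sign l.1 := C.sign_pairing l
      simp only [Finset.mem_filter, Finset.mem_univ, true_and] at hl ⊢
      rw [hs, hl]; decide
    · intro l hl
      simp only [Finset.mem_filter, Finset.mem_univ, true_and] at hl ⊢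
      exact C.sign_pairing_of_ne l hl
  have h2 := Finset.card_filter_add_card_filter_not (s := Finset.univ)
    (fun l : C.Leaf => C.sign l.1 = 1)
  rw [Finset.card_univ, card_leaf] at h2
  rw [Fintype.card_subtype]
  omega

/-- Some leaf of the left tree is paired with a leaf of the right tree. -/
theorem exists_crossing : ∃ l : C.Leaf, l.1.1 = 0 ∧ (C.pairing l).1.1 ≠ 0 := by
  by_contra! h
  refine (Nat.not_even_iff_odd.2 (C.odd_card_side 0))
    (even_card_of_involutive C.involutive C.pairing_ne _ fun l hl => ?_)
  simp only [Finset.mem_filter, Finset.mem_univ, true_and] at hl ⊢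
  exact h l hl

/-- One of the variables is determined by the other ones and the wave number of the root. -/
theorem exists_dependent_leaf (d : ℕ) : ∃ p : C.PosLeaf, ∀ V : C.PosLeaf → Vec d,
    (∀ l, l ≠ p → V l = 0) → C.wave V ⟨0, []⟩ = 0 → V p = 0 := by
  obtain ⟨e, he, he'⟩ := C.exists_crossing
  obtain ⟨p, hp⟩ : ∃ p : C.PosLeaf, p.1 = e ∨ p.1 = C.pairing e := by
    by_cases h : C.sign e.1 = 1
    · exact ⟨⟨e, h⟩, Or.inl rfl⟩
    · exact ⟨⟨C.pairing e, C.sign_pairing_of_ne e h⟩, Or.inr rfl⟩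
  refine ⟨p, fun V hV hw => ?_⟩
  have hsum : C.wave V ⟨0, []⟩ = C.leafWave V e := by
    refine Finset.sum_eq_single_of_mem e (by simp [below_root, he]) fun l hl hle => ?_
    simp only [Finset.mem_filter, Finset.mem_univ, true_and, below_root] at hl
    unfold leafWave
    split_ifs with h
    · refine hV _ fun h' => ?_
      rw [← h'] at hp
      rcases hp with hp | hp
      · exact hle hp
      · exact he' (hp ▸ hl)
    · rw [neg_eq_zero]
      refine hV _ fun h' => ?_
      rw [← h'] at hp
      rcases hp with hp | hp
      · exact he' (by rw [← hp, C.involutive]; exact hl)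
      · exact hle (C.involutive.injective hp)
  rw [hsum] at hw
  unfold leafWave at hw
  split_ifs at hw with h
  · have : p = ⟨e, h⟩ := by
      rcases hp with hp | hp
      · exact Subtype.ext hp
      · have h1 : C.sign (C.pairing e).1 = - C.sign e.1 := C.sign_pairing e
        have h2 := p.2
        rw [hp, h1, h] at h2
        exact absurd h2 (by decide)
    rw [this, hw]
  · have : p = ⟨C.pairing e, C.sign_pairing_of_ne e h⟩ := by
      rcases hp with hp | hp
      · exact absurd (hp ▸ p.2) h
      · exact Subtype.ext hp
    rw [this]
    exact neg_eq_zero.1 hw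

/-- The decorations with values in the ball of radius `r`. -/
def ballDecorations (L r : ℝ) (k : Vec d) : Set (C.PosLeaf → Vec d) :=
  {κ | κ ∈ C.decorations L k ∧ ∀ l, ‖κ l‖ ≤ r}

theorem finite_ballDecorations_and_ncard_le {L r : ℝ} (hL : 1 ≤ L) (hr : 0 ≤ r) (k : Vec d) :
    (C.ballDecorations L r k).Finite ∧
      ((C.ballDecorations L r k).ncard : ℝ) ≤ (((2 * r + 1) * L) ^ d) ^ (2 * C.order) := by
  classical
  obtain ⟨p, hp⟩ := C.exists_dependent_leaf d
  obtain ⟨B, hB, hBcard⟩ := exists_finset_lattice_ball d hL hr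
  set φ : (C.PosLeaf → Vec d) → ({l : C.PosLeaf // l ≠ p} → Vec d) := fun κ l => κ l.1 with hφ
  set T : Finset ({l : C.PosLeaf // l ≠ p} → Vec d) := Fintype.piFinset fun _ => B with hT
  have hmaps : ∀ κ ∈ C.ballDecorations L r k, φ κ ∈ (T : Set _) := by
    intro κ hκ
    rw [Finset.mem_coe, hT, Fintype.mem_piFinset]
    exact fun l => hB _ (hκ.1.1 l.1) (hκ.2 l.1)
  -- The difference of two decorations that agree off `p` has root wave number zero, so it also
  -- vanishes at `p`.
  have hinj : Set.InjOn φ (C.ballDecorations L r k) := by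
    intro κ hκ κ' hκ' h
    have hoff : ∀ l, l ≠ p → κ l = κ' l := fun l hl => congrFun h ⟨l, hl⟩
    have hw : C.wave (fun l => κ' l - κ l) ⟨0, []⟩ = 0 := by
      have h1 := C.wave_add_smul κ (fun l => κ' l - κ l) 1 ⟨0, []⟩
      simp only [one_smul, add_sub_cancel] at h1
      have h2 : C.wave κ ⟨0, []⟩ = k := hκ.1.2
      have h3 : C.wave κ' ⟨0, []⟩ = k := hκ'.1.2
      have h4 : C.wave (fun l => κ' l) ⟨0, []⟩ = k := h3
      rw [h4, h2] at h1
      exact left_eq_add.1 h1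
    have h0 := hp _ (fun l hl => by rw [hoff l hl, sub_self]) hw
    funext l
    by_cases hl : l = p
    · rw [hl]; exact (sub_eq_zero.1 h0).symm
    · exact hoff l hl
  refine ⟨Set.Finite.of_injOn hmaps hinj T.finite_toSet, ?_⟩
  have h1 := Set.ncard_le_ncard_of_injOn φ hmaps hinj T.finite_toSet
  rw [Set.ncard_coe_finset, hT, Fintype.card_piFinset, Finset.prod_const, Finset.card_univ,
    Fintype.card_subtype_compl, Fintype.card_subtype_eq, card_posLeaf, Nat.add_sub_cancel] at h1
  calc ((C.ballDecorations L r k).ncard : ℝ) ≤ ((B.card ^ (2 * C.order) : ℕ) : ℝ) := by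
        exact_mod_cast h1
    _ ≤ _ := by
        rw [Nat.cast_pow]
        exact pow_le_pow_left₀ (Nat.cast_nonneg _) hBcard _

/-- Few decorations are almost resonant at a non-resonant node. -/
theorem mul_ncard_almost_resonant_le (hd : 0 < d) {n : Vertex} (hn : n ∈ C.nodes)
    (hres : ¬ C.IsResonant d n) {L r : ℝ} (hL : 1 ≤ L) (hr : 0 ≤ r) (k : Vec d) (μ : ℝ) :
    L * ({κ ∈ C.ballDecorations L r k | |C.resonanceFactor κ n| ≤ μ}.ncard : ℝ) ≤
      (((2 * (r + 4) + 1) * L) ^ d) ^ (2 * C.order) * (2 * (L * √(2 * μ) + 1)) := by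
  classical
  have hL0 : 0 < L := by linarith
  obtain ⟨V, hVint, hV0, hV⟩ := C.exists_direction hn hres (⟨0, hd⟩ : Fin d)
  obtain ⟨hfin, hcard⟩ := C.finite_ballDecorations_and_ncard_le hL (r := r + 4) (by linarith) k
  have hfinr := (C.finite_ballDecorations_and_ncard_le hL hr k).1
  have hbadfin : {κ ∈ C.ballDecorations L r k | |C.resonanceFactor κ n| ≤ μ}.Finite :=
    hfinr.subset fun κ h => h.1
  rw [Set.ncard_eq_toFinset_card _ hbadfin]
  rw [Set.ncard_eq_toFinset_card _ hfin] at hcard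
  set Bad := hbadfin.toFinset with hBad
  set D := hfin.toFinset with hD
  set N := ⌈L⌉₊ with hN
  set G : (C.PosLeaf → Vec d) → Finset ℕ := fun κ => (Finset.range N).filter fun j : ℕ =>
    |C.resonanceFactor (fun l => κ l + ((j : ℝ) / L) • V l) n| ≤ μ with hG
  have hGcard : ∀ κ, ((G κ).card : ℝ) ≤ 2 * (L * √(2 * μ) + 1) := by
    intro κ
    obtain ⟨b, hb⟩ := C.exists_resonanceFactor_line κ V n
    simp only [hG, hb]
    exact card_quadratic_le hV hL0 N
  -- Double counting: each bad decoration is shifted back by `j / L` along `V`. As `j / L ≤ 1` and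
  -- the coefficients of `V` are at most `4`, the result stays in the ball of radius `r + 4`, and
  -- `j` is one of the few bad parameters on the line through it.
  set ψ : ℕ × (C.PosLeaf → Vec d) → (Σ _ : C.PosLeaf → Vec d, ℕ) :=
    fun x => ⟨fun l => x.2 l + (-((x.1 : ℝ) / L)) • V l, x.1⟩ with hψ
  have hmaps : ∀ x ∈ Finset.range N ×ˢ Bad, ψ x ∈ D.sigma G := by
    rintro ⟨j, κ⟩ hx
    rw [Finset.mem_product, Finset.mem_range, hBad, Set.Finite.mem_toFinset] at hx
    obtain ⟨hj, ⟨⟨hlat, hroot⟩, hnorm⟩, hsmall⟩ := hx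
    have hjL : (j : ℝ) < L := Nat.lt_ceil.1 hj
    rw [Finset.mem_sigma, hD, Set.Finite.mem_toFinset]
    refine ⟨⟨⟨fun l => ?_, ?_⟩, fun l => ?_⟩, ?_⟩
    · obtain ⟨z, -, hz⟩ := hVint l
      obtain ⟨m, hm⟩ := hlat l
      refine ⟨fun i => m i - j * (z * if i = ⟨0, hd⟩ then 1 else 0), fun i => ?_⟩
      have hmi : κ l i = m i / L := hm i
      change (κ l + (-((j : ℝ) / L)) • V l) i = _
      simp only [hz, PiLp.add_apply, PiLp.smul_apply, hmi, PiLp.single_apply, smul_eq_mul]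
      push_cast
      ring
    · change C.wave (fun l => κ l + (-((j : ℝ) / L)) • V l) ⟨0, []⟩ = k
      rw [wave_add_smul, hV0, smul_zero, add_zero]
      exact hroot
    · obtain ⟨z, hz4, hz⟩ := hVint l
      have hz4' : |(z : ℝ)| ≤ 4 := by exact_mod_cast hz4
      have hjL' : |(j : ℝ) / L| ≤ 1 := by
        rw [abs_of_nonneg (by positivity), div_le_one hL0]; exact hjL.le
      refine (norm_add_le _ _).trans (add_le_add (hnorm l) ?_)
      rw [norm_smul, hz, norm_smul, Real.norm_eq_abs, Real.norm_eq_abs, abs_neg]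
      simp only [PiLp.norm_single, norm_one, mul_one]
      nlinarith [abs_nonneg (z : ℝ), abs_nonneg ((j : ℝ) / L)]
    · simp only [hG, hψ, Finset.mem_filter, Finset.mem_range]
      refine ⟨hj, ?_⟩
      convert hsmall using 3
      funext l
      module
  have hinj : Set.InjOn ψ (Finset.range N ×ˢ Bad : Finset _) := by
    rintro ⟨j, κ⟩ - ⟨j', κ'⟩ - h
    simp only [hψ, Sigma.mk.injEq, heq_eq_eq] at h
    obtain ⟨h1, rfl⟩ := h
    refine Prod.ext rfl (funext fun l => ?_)
    exact add_right_cancel (congrFun h1 l)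
  have hle := Finset.card_le_card_of_injOn ψ hmaps hinj
  rw [Finset.card_product, Finset.card_range, Finset.card_sigma] at hle
  calc L * (Bad.card : ℝ) ≤ N * (Bad.card : ℝ) :=
        mul_le_mul_of_nonneg_right (Nat.le_ceil L) (Nat.cast_nonneg _)
    _ ≤ ∑ κ ∈ D, ((G κ).card : ℝ) := by exact_mod_cast hle
    _ ≤ ∑ _κ ∈ D, 2 * (L * √(2 * μ) + 1) := Finset.sum_le_sum fun κ _ => hGcard κ
    _ = D.card * (2 * (L * √(2 * μ) + 1)) := by rw [Finset.sum_const, nsmul_eq_mul]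
    _ ≤ _ := mul_le_mul_of_nonneg_right hcard (by positivity)

end Couple

/-! ### Oscillatory integrals -/

open MeasureTheory

/-- The set is empty or a compact interval, and the primitive of the phase has modulus `1 / |lam|`
at both ends. -/
theorem norm_setIntegral_exp_le {A : Set ℝ} (hord : A.OrdConnected) (hA : IsCompact A) {lam : ℝ}
    (hl : lam ≠ 0) : ‖∫ x in A, Complex.exp (Complex.I * ((lam * x : ℝ) : ℂ))‖ ≤ 2 / |lam| := by
  rcases A.eq_empty_or_nonempty with rfl | hne
  · simp; positivity
  rw [eq_Icc_of_connected_compact ⟨hne, hord.isPreconnected⟩ hA, integral_Icc_eq_integral_Ioc,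
    ← intervalIntegral.integral_of_le (Real.sInf_le_sSup _ hA.bddBelow hA.bddAbove)]
  have hc : Complex.I * (lam : ℂ) ≠ 0 := mul_ne_zero Complex.I_ne_zero (by exact_mod_cast hl)
  have h : ∀ x : ℝ, Complex.exp (Complex.I * ((lam * x : ℝ) : ℂ))
      = Complex.exp (Complex.I * (lam : ℂ) * (x : ℂ)) := by
    intro x; push_cast; rw [mul_assoc]
  simp only [h]
  rw [integral_exp_mul_complex hc, norm_div]
  have h1 : ∀ x : ℝ, ‖Complex.exp (Complex.I * (lam : ℂ) * (x : ℂ))‖ = 1 := by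
    intro x; rw [← h, Complex.norm_exp_I_mul_ofReal]
  have h2 : ‖Complex.I * (lam : ℂ)‖ = |lam| := by simp
  rw [h2]
  refine div_le_div_of_nonneg_right ((norm_sub_le _ _).trans ?_) (abs_nonneg _)
  rw [h1, h1]; norm_num

/-- An integral of separated phases over a compact set whose sections in one coordinate are
intervals gains the inverse of the frequency of that coordinate. -/
theorem norm_setIntegral_prod_exp_le {N : Type*} [Fintype N] [DecidableEq N] (n₀ : N)
    {S : Set (N → ℝ)} (hS : IsCompact S) {t : ℝ} (ht : 0 ≤ t) (hSt : ∀ τ ∈ S, ∀ n, τ n ∈ Set.Icc 0 t)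
    (hord : ∀ τ, {x : ℝ | Function.update τ n₀ x ∈ S}.OrdConnected) (lam : N → ℝ)
    (hl : lam n₀ ≠ 0) :
    ‖∫ τ in S, ∏ n, Complex.exp (Complex.I * ((lam n * τ n : ℝ) : ℂ))‖
      ≤ t ^ (Fintype.card N - 1) * (2 / |lam n₀|) := by
  set F : (N → ℝ) → ℂ := S.indicator fun τ => ∏ n, Complex.exp (Complex.I * ((lam n * τ n : ℝ) : ℂ))
    with hF
  have hFint : Integrable F := by
    rw [hF, integrable_indicator_iff hS.measurableSet]
    refine ContinuousOn.integrableOn_compact hS (Continuous.continuousOn ?_)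
    fun_prop
  rw [← integral_indicator hS.measurableSet]
  change ‖∫ τ, F τ‖ ≤ _
  -- Fubini with the coordinate `n₀` innermost: the other phases form a constant of modulus `1` on
  -- each section, and the outer variables range over a cube.
  set E := MeasurableEquiv.piEquivPiSubtypeProd (fun _ : N => ℝ) (fun n => n = n₀) with hE
  have hEmp : MeasurePreserving E := by
    convert volume_preserving_piEquivPiSubtypeProd (fun _ : N => ℝ) (fun n => n = n₀)
  set U := MeasurableEquiv.funUnique {n : N // n = n₀} ℝ with hU
  have hUmp : MeasurePreserving U := volume_preserving_funUnique _ ℝ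
  set T : Set ({n : N // ¬ n = n₀} → ℝ) := Set.Icc (fun _ => 0) (fun _ => t) with hT
  have hTvol : volume.real T = t ^ (Fintype.card N - 1) := by
    rw [measureReal_def, hT, Real.volume_Icc_pi_toReal fun _ => ht]
    simp only [sub_zero, Finset.prod_const, Finset.card_univ, Fintype.card_subtype_compl,
      Fintype.card_subtype_eq]
  have hsymm : ∀ (x : ℝ) y, E.symm (U.symm x, y)
      = Function.update (fun n => if h : n = n₀ then 0 else y ⟨n, h⟩) n₀ x := by
    intro x y
    funext n
    by_cases h : n = n₀
    · subst h
      simp [hE, hU, MeasurableEquiv.piEquivPiSubtypeProd]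
    · simp [hE, MeasurableEquiv.piEquivPiSubtypeProd, h]
  have hinner : ∀ y, ‖∫ x, F (E.symm (x, y))‖ ≤ T.indicator (fun _ => 2 / |lam n₀|) y := by
    intro y
    by_cases hy : y ∈ T
    · rw [Set.indicator_of_mem hy, ← hUmp.symm.integral_comp U.symm.measurableEmbedding]
      simp only [hsymm]
      set τ : N → ℝ := fun n => if h : n = n₀ then 0 else y ⟨n, h⟩ with hτ
      set A := {x : ℝ | Function.update τ n₀ x ∈ S} with hA
      have hAcpt : IsCompact A := by
        refine isCompact_Icc.of_isClosed_subset (s := Set.Icc 0 t)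
          (hS.isClosed.preimage (continuous_const.update n₀ continuous_id)) fun x hx => ?_
        simpa using hSt _ hx n₀
      set c : ℂ := ∏ n ∈ Finset.univ.erase n₀, Complex.exp (Complex.I * ((lam n * τ n : ℝ) : ℂ))
        with hc
      have hcnorm : ‖c‖ = 1 := by
        rw [hc, norm_prod]
        exact Finset.prod_eq_one fun n _ => Complex.norm_exp_I_mul_ofReal _
      have hFx : ∀ x, F (Function.update τ n₀ x)
          = A.indicator (fun x : ℝ => Complex.exp (Complex.I * ((lam n₀ * x : ℝ) : ℂ)) * c) x := by
        intro x
        by_cases hx : x ∈ A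
        · rw [Set.indicator_of_mem hx, hF, Set.indicator_of_mem (show _ ∈ S from hx),
            ← Finset.mul_prod_erase _ _ (Finset.mem_univ n₀), Function.update_self, hc]
          congr 1
          refine Finset.prod_congr rfl fun n hn => ?_
          rw [Function.update_of_ne (Finset.ne_of_mem_erase hn)]
        · rw [Set.indicator_of_notMem hx, hF, Set.indicator_of_notMem (show _ ∉ S from hx)]
      simp only [hFx]
      rw [integral_indicator hAcpt.measurableSet, integral_mul_const, norm_mul, hcnorm, mul_one]
      exact norm_setIntegral_exp_le (hord τ) hAcpt hl
    · rw [Set.indicator_of_notMem hy]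
      have h0 : ∀ x, F (E.symm (x, y)) = 0 := by
        intro x
        refine Set.indicator_of_notMem (fun hx => hy ?_) _
        have hval : ∀ n : {n : N // ¬ n = n₀}, E.symm (x, y) n.1 = y n := by
          intro n
          simp [hE, MeasurableEquiv.piEquivPiSubtypeProd, n.2]
        exact ⟨fun n => by simpa only [hval] using (hSt _ hx n.1).1,
          fun n => by simpa only [hval] using (hSt _ hx n.1).2⟩
      simp [h0]
  have h1 : ∫ τ, F τ = ∫ y, ∫ x, F (E.symm (x, y)) := by
    rw [← hEmp.symm.integral_comp E.symm.measurableEmbedding F]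
    exact integral_prod_symm _ ((hEmp.symm.integrable_comp_emb E.symm.measurableEmbedding).2 hFint)
  have hTm : MeasurableSet T := measurableSet_Icc
  have hTfin : volume T ≠ ⊤ := isCompact_Icc.measure_lt_top.ne
  rw [h1]
  refine (norm_integral_le_of_norm_le ((integrable_indicator_iff hTm).2
    (integrableOn_const hTfin)) (Filter.Eventually.of_forall hinner)).trans ?_
  rw [integral_indicator hTm, setIntegral_const, hTvol, smul_eq_mul]

/-! ### Time integrals of couples -/

namespace Couple

variable (C : Couple) {d : ℕ}

theorem isCompact_timeDomain (t : ℝ) : IsCompact (C.timeDomain t) := by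
  have h : C.timeDomain t = (Set.univ.pi fun _ => Set.Icc 0 t) ∩
      {τ | ∀ n n' : C.Node, n.1.Below n'.1 → τ n ≤ τ n'} := by
    ext τ; simp only [timeDomain, Set.mem_inter_iff, Set.mem_univ_pi, Set.mem_ofPred_eq]
  rw [h]
  refine (isCompact_univ_pi fun _ => isCompact_Icc).inter_right ?_
  simp only [Set.ofPred_forall]
  exact isClosed_iInter fun n => isClosed_iInter fun n' => isClosed_iInter fun _ =>
    isClosed_le (continuous_apply n) (continuous_apply n')

/-- With the other times fixed, each constraint bounds the time of `n₀` from one side or does not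
involve it, apart from the trivial comparison of `n₀` with itself. -/
theorem ordConnected_timeDomain_section (t : ℝ) (τ : C.Node → ℝ) (n₀ : C.Node) :
    {x : ℝ | Function.update τ n₀ x ∈ C.timeDomain t}.OrdConnected := by
  have hupd : ∀ (x : ℝ) n, Function.update τ n₀ x n = if n = n₀ then x else τ n :=
    fun x n => Function.update_apply τ n₀ x n
  refine ⟨fun x hx y hy z hz => ⟨fun n => ?_, fun n n' hnn => ?_⟩⟩
  · have h1 := hx.1 n
    have h2 := hy.1 n
    rw [hupd, Set.mem_Icc] at h1 h2 ⊢
    split_ifs at h1 h2 ⊢ with h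
    · exact ⟨h1.1.trans hz.1, hz.2.trans h2.2⟩
    · exact h1
  · have h1 := hx.2 n n' hnn
    have h2 := hy.2 n n' hnn
    rw [hupd, hupd] at h1 h2 ⊢
    split_ifs at h1 h2 ⊢
    · exact le_rfl
    · exact hz.2.trans h2
    · exact h1.trans hz.1
    · exact h1

/-- The time integral of a couple. -/
noncomputable def timeIntegral (ε t : ℝ) (κ : C.PosLeaf → Vec d) : ℂ :=
  ∫ τ in C.timeDomain t, ∏ n : C.Node, Complex.exp (Complex.I * ((((C.sign n.1 : ℤ) : ℝ) * ε⁻¹ *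
    C.resonanceFactor κ n.1 * τ n : ℝ) : ℂ))

theorem card_node : Fintype.card C.Node = C.order := Fintype.card_coe _

theorem norm_timeIntegral_le (ε : ℝ) {t : ℝ} (ht : 0 ≤ t) (κ : C.PosLeaf → Vec d) :
    ‖C.timeIntegral ε t κ‖ ≤ t ^ C.order := by
  have hsub : C.timeDomain t ⊆ Set.Icc (fun _ => 0) (fun _ => t) := fun τ hτ =>
    ⟨fun n => (hτ.1 n).1, fun n => (hτ.1 n).2⟩
  have hfin : volume (Set.Icc (fun _ : C.Node => (0 : ℝ)) (fun _ => t)) ≠ ⊤ :=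
    isCompact_Icc.measure_lt_top.ne
  refine (norm_setIntegral_le_of_norm_le_const
    (C.isCompact_timeDomain t).measure_lt_top (C := 1) fun τ _ => ?_).trans ?_
  · rw [norm_prod]
    exact (Finset.prod_eq_one fun n _ => Complex.norm_exp_I_mul_ofReal _).le
  · rw [one_mul]
    refine (measureReal_mono hsub hfin).trans ?_
    rw [measureReal_def, Real.volume_Icc_pi_toReal fun _ => ht]
    simp [order]

theorem norm_timeIntegral_le_of_node {ε t : ℝ} (hε : 0 < ε) (ht : 0 ≤ t) (κ : C.PosLeaf → Vec d)
    (n : C.Node) (hn : C.resonanceFactor κ n.1 ≠ 0) :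
    ‖C.timeIntegral ε t κ‖ ≤ t ^ (C.order - 1) * (2 * ε / |C.resonanceFactor κ n.1|) := by
  classical
  have hs : |((C.sign n.1 : ℤ) : ℝ)| = 1 := by
    rcases Int.units_eq_one_or (C.sign n.1) with h | h <;> simp [h]
  have hs0 : ((C.sign n.1 : ℤ) : ℝ) ≠ 0 := by
    intro h; rw [h] at hs; simp at hs
  have h := norm_setIntegral_prod_exp_le n (C.isCompact_timeDomain t) ht (fun τ hτ => hτ.1)
    (fun τ => C.ordConnected_timeDomain_section t τ n)
    (fun m => ((C.sign m.1 : ℤ) : ℝ) * ε⁻¹ * C.resonanceFactor κ m.1)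
    (mul_ne_zero (mul_ne_zero hs0 (inv_ne_zero hε.ne')) hn)
  rw [card_node, abs_mul, abs_mul, hs, one_mul, abs_of_pos (inv_pos.2 hε)] at h
  refine h.trans (le_of_eq ?_)
  have := abs_pos.2 hn
  field_simp

end Couple

/-! ### Bounds for amplitudes -/

/-- The essential bound holds on a dense set, and continuity extends it to every point, hence to the
lattice. -/
theorem SobolevClass.exists_bound {V : Type*} [NormedAddCommGroup V] [NormedSpace ℝ V]
    [MeasureSpace V] [(volume : Measure V).IsOpenPosMeasure] {f : V → ℂ} (hf : SobolevClass f) :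
    ∃ B : ℝ, ∀ x, ‖f x‖ ≤ B := by
  obtain ⟨hcont, -, hmem, -⟩ := hf
  have hfin : eLpNormEssSup f volume < ⊤ := by
    rw [← eLpNorm_exponent_top]
    exact hmem.2
  set B := (eLpNormEssSup f volume).toReal
  have hB : ∀ᵐ x, ‖f x‖ ≤ B := by
    filter_upwards [ae_le_eLpNormEssSup (f := f) (μ := volume)] with x hx
    rw [← toReal_enorm]
    exact ENNReal.toReal_mono hfin.ne hx
  refine ⟨B, fun x => ?_⟩
  have hdense : Dense {x | ‖f x‖ ≤ B} := Measure.dense_of_ae hB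
  have hclosed : IsClosed {x | ‖f x‖ ≤ B} := isClosed_le hcont.norm continuous_const
  exact (hclosed.closure_eq ▸ hdense x : x ∈ {x | ‖f x‖ ≤ B})

theorem norm_signConj (ι : ℤˣ) (z : ℂ) : ‖signConj ι z‖ = ‖z‖ := by
  unfold signConj
  split_ifs
  · rfl
  · exact RCLike.norm_conj z

namespace Couple

variable (C : Couple) {d : ℕ}

/-- The summand of the amplitude that belongs to a decoration. -/
noncomputable def summand (Q : Fin 2 → (Fin 5 → Vec d) → ℂ) (M : Fin 2 → Fin 2 → Vec d → ℂ)
    (ε t : ℝ) (κ : C.PosLeaf → Vec d) : ℂ :=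
  (∏ n : C.Node, C.vertexFactor Q κ n.1) * C.timeIntegral ε t κ *
    ∏ l : C.PosLeaf,
      signConj (C.sign l.1.1) (M (C.colour l.1.1) (C.colour (C.pairing l.1).1) (κ l))

variable {Q : Fin 2 → (Fin 5 → Vec d) → ℂ} {M : Fin 2 → Fin 2 → Vec d → ℂ}

theorem norm_summand_le {B : ℝ} (hQ : ∀ η x, ‖Q η x‖ ≤ B) (hM : ∀ η η' x, ‖M η η' x‖ ≤ B)
    (ε t : ℝ) (κ : C.PosLeaf → Vec d) :
    ‖C.summand Q M ε t κ‖ ≤ B ^ (3 * C.order + 1) * ‖C.timeIntegral ε t κ‖ := by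
  have h1 : ‖∏ n : C.Node, C.vertexFactor Q κ n.1‖ ≤ B ^ C.order := by
    rw [norm_prod, ← C.card_node, ← Finset.card_univ, ← Finset.prod_const]
    refine Finset.prod_le_prod (fun _ _ => norm_nonneg _) fun n _ => ?_
    rw [vertexFactor, norm_signConj]
    exact hQ _ _
  have h2 : ‖∏ l : C.PosLeaf,
      signConj (C.sign l.1.1) (M (C.colour l.1.1) (C.colour (C.pairing l.1).1) (κ l))‖
      ≤ B ^ (2 * C.order + 1) := by
    rw [norm_prod, ← C.card_posLeaf, ← Finset.card_univ, ← Finset.prod_const]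
    refine Finset.prod_le_prod (fun _ _ => norm_nonneg _) fun n _ => ?_
    rw [norm_signConj]
    exact hM _ _ _
  have hB : 0 ≤ B := (norm_nonneg _).trans (hM 0 0 0)
  rw [summand, norm_mul, norm_mul]
  calc _ ≤ B ^ C.order * ‖C.timeIntegral ε t κ‖ * B ^ (2 * C.order + 1) := by gcongr
    _ = _ := by rw [show 3 * C.order + 1 = C.order + (2 * C.order + 1) by ring, pow_add]; ring

theorem summand_eq_zero {R : ℝ} (hsupp : ∀ η η' ξ, M η η' ξ ≠ 0 → ‖ξ‖ ≤ R) (ε t : ℝ)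
    {κ : C.PosLeaf → Vec d} (hκ : ¬ ∀ l, ‖κ l‖ ≤ R) : C.summand Q M ε t κ = 0 := by
  push Not at hκ
  obtain ⟨l, hl⟩ := hκ
  have hM0 : ∀ η η', M η η' (κ l) = 0 := by
    intro η η'
    by_contra h
    exact absurd (hsupp _ _ _ h) (not_le.2 hl)
  refine mul_eq_zero_of_right _ (Finset.prod_eq_zero (Finset.mem_univ l) ?_)
  rw [hM0]
  simp [signConj]

theorem norm_amplitude_le_sum {L R : ℝ} (hL : 0 < L)
    (hsupp : ∀ η η' ξ, M η η' ξ ≠ 0 → ‖ξ‖ ≤ R) (ε t : ℝ) (k : Vec d)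
    {D : Finset (C.PosLeaf → Vec d)} (hD : ∀ κ, κ ∈ D ↔ κ ∈ C.ballDecorations L R k) :
    ‖C.amplitude Q M L ε t k‖
      ≤ ((L ^ (2 * d))⁻¹) ^ C.order * ∑ κ ∈ D, ‖C.summand Q M ε t κ‖ := by
  have h1 : C.amplitude Q M L ε t k = (-Complex.I / (L : ℂ) ^ (2 * d)) ^ C.order *
      (∏ n : C.Node, ((C.sign n.1 : ℤ) : ℂ)) *
        ∑' κ : C.decorations L k, C.summand Q M ε t κ.1 := rfl
  have h2 : ∑' κ : C.decorations L k, C.summand Q M ε t κ.1 = ∑ κ ∈ D, C.summand Q M ε t κ := by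
    rw [tsum_subtype (C.decorations L k) (C.summand Q M ε t), tsum_eq_sum (s := D)]
    · refine Finset.sum_congr rfl fun κ hκ => Set.indicator_of_mem ((hD κ).1 hκ).1 _
    · intro κ hκ
      by_cases h : κ ∈ C.decorations L k
      · rw [Set.indicator_of_mem h]
        exact C.summand_eq_zero hsupp ε t fun h' => hκ ((hD κ).2 ⟨h, h'⟩)
      · exact Set.indicator_of_notMem h _
  have h3 : ‖∏ n : C.Node, ((C.sign n.1 : ℤ) : ℂ)‖ = 1 := by
    rw [norm_prod]
    refine Finset.prod_eq_one fun n _ => ?_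
    rcases Int.units_eq_one_or (C.sign n.1) with h | h <;> simp [h]
  rw [h1, h2, norm_mul, norm_mul, h3, mul_one, norm_pow, norm_div, norm_pow, norm_neg,
    Complex.norm_I, Complex.norm_real, Real.norm_eq_abs, abs_of_pos hL, one_div]
  exact mul_le_mul_of_nonneg_left (norm_sum_le _ _) (by positivity)

theorem sum_norm_timeIntegral_le (hd : 0 < d) (n : C.Node) (hres : ¬ C.IsResonant d n.1)
    {L R : ℝ} (hL : 1 ≤ L) (hR : 0 ≤ R) (k : Vec d) {q : ℝ} (hq0 : 0 < q) (hq1 : q ≤ 1)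
    (hLq : 1 / L ≤ q) {t Δ : ℝ} (ht : 0 ≤ t) (htΔ : t ≤ Δ) (hΔ : 1 ≤ Δ)
    {D : Finset (C.PosLeaf → Vec d)} (hD : ∀ κ, κ ∈ D ↔ κ ∈ C.ballDecorations L R k) :
    ∑ κ ∈ D, ‖C.timeIntegral (q ^ 4) t κ‖
      ≤ Δ ^ C.order * (((2 * R + 9) * L) ^ d) ^ (2 * C.order) * (8 * q) := by
  classical
  have hL0 : 0 < L := by linarith
  set P := (((2 * R + 9) * L) ^ d) ^ (2 * C.order) with hP
  have hP0 : 0 ≤ P := by positivity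
  have hall : (D.card : ℝ) ≤ P := by
    have h1 := (C.finite_ballDecorations_and_ncard_le hL hR k).2
    have h2 : C.ballDecorations L R k = (D : Set _) := by ext κ; rw [Finset.mem_coe, hD]
    rw [h2, Set.ncard_coe_finset] at h1
    refine h1.trans ?_
    rw [hP]
    gcongr
    linarith
  set bad := D.filter fun κ => |C.resonanceFactor κ n.1| ≤ q ^ 2 with hbad
  have hbadcard : (bad.card : ℝ) ≤ P * (6 * q) := by
    have h1 := C.mul_ncard_almost_resonant_le hd n.2 hres hL hR k (q ^ 2)
    have h2 : {κ ∈ C.ballDecorations L R k | |C.resonanceFactor κ n.1| ≤ q ^ 2} = (bad : Set _) := by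
      ext κ
      rw [Finset.mem_coe, hbad, Finset.mem_filter, hD]
      rfl
    rw [h2, Set.ncard_coe_finset, show 2 * (R + 4) + 1 = 2 * R + 9 by ring, ← hP] at h1
    have h3 : √(2 * q ^ 2) ≤ 2 * q := by
      rw [Real.sqrt_le_left (by positivity)]
      nlinarith
    -- This absorbs the `+ 1` of the line count, so that `2 * (2 * q * L + q * L)` gives the
    -- constant `6`.
    have h4 : 1 ≤ q * L := by rwa [div_le_iff₀ hL0] at hLq
    have h5 : L * (bad.card : ℝ) ≤ L * (P * (6 * q)) := by
      refine h1.trans ?_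
      calc P * (2 * (L * √(2 * q ^ 2) + 1)) ≤ P * (2 * (L * (2 * q) + q * L)) := by gcongr
        _ = L * (P * (6 * q)) := by ring
    exact le_of_mul_le_mul_left h5 hL0
  have hΔpow : ∀ m, m ≤ C.order → t ^ m ≤ Δ ^ C.order := fun m hm =>
    (pow_le_pow_left₀ ht htΔ m).trans (pow_le_pow_right₀ hΔ hm)
  have hterm : ∀ κ ∈ D, ‖C.timeIntegral (q ^ 4) t κ‖
      ≤ Δ ^ C.order * (2 * q) + if |C.resonanceFactor κ n.1| ≤ q ^ 2 then Δ ^ C.order else 0 := by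
    intro κ _
    split_ifs with h
    · have h1 := (C.norm_timeIntegral_le (q ^ 4) ht κ).trans (hΔpow _ le_rfl)
      have h2 : 0 ≤ Δ ^ C.order * (2 * q) := by positivity
      linarith
    · rw [add_zero]
      push Not at h
      have hpos : 0 < |C.resonanceFactor κ n.1| := lt_of_le_of_lt (by positivity) h
      refine (C.norm_timeIntegral_le_of_node (by positivity) ht κ n (abs_pos.1 hpos)).trans ?_
      refine mul_le_mul (hΔpow _ (Nat.sub_le _ _)) ?_ (by positivity) (by positivity)
      rw [div_le_iff₀ hpos]
      calc 2 * q ^ 4 = 2 * (q * q) * q ^ 2 := by ring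
        _ ≤ 2 * (q * 1) * |C.resonanceFactor κ n.1| := by gcongr
        _ = _ := by ring
  calc _ ≤ ∑ κ ∈ D, (Δ ^ C.order * (2 * q) +
          if |C.resonanceFactor κ n.1| ≤ q ^ 2 then Δ ^ C.order else 0) := Finset.sum_le_sum hterm
    _ = D.card * (Δ ^ C.order * (2 * q)) + bad.card * Δ ^ C.order := by
        rw [Finset.sum_add_distrib, ← Finset.sum_filter, Finset.sum_const, Finset.sum_const,
          nsmul_eq_mul, nsmul_eq_mul]
    _ ≤ P * (Δ ^ C.order * (2 * q)) + P * (6 * q) * Δ ^ C.order := by gcongr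
    _ = _ := by ring

theorem norm_amplitude_le (hd : 0 < d) (n : C.Node) (hres : ¬ C.IsResonant d n.1)
    {B : ℝ} (hB : 1 ≤ B) (hQ : ∀ η x, ‖Q η x‖ ≤ B) (hM : ∀ η η' x, ‖M η η' x‖ ≤ B)
    {L R : ℝ} (hL : 1 ≤ L) (hR : 0 ≤ R) (hsupp : ∀ η η' ξ, M η η' ξ ≠ 0 → ‖ξ‖ ≤ R)
    (k : Vec d) {q : ℝ} (hq0 : 0 < q) (hq1 : q ≤ 1)
    (hLq : 1 / L ≤ q) {t Δ : ℝ} (ht : 0 ≤ t) (htΔ : t ≤ Δ) (hΔ : 1 ≤ Δ) :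
    ‖C.amplitude Q M L (q ^ 4) t k‖
      ≤ (8 * B ^ 3 * Δ * (2 * R + 9) ^ (2 * d)) ^ (C.order + 1) * q := by
  have hL0 : 0 < L := by linarith
  have hfin := (C.finite_ballDecorations_and_ncard_le hL hR k).1
  have hD : ∀ κ, κ ∈ hfin.toFinset ↔ κ ∈ C.ballDecorations L R k := fun κ => hfin.mem_toFinset
  refine (C.norm_amplitude_le_sum hL0 hsupp _ t k hD).trans ?_
  have h1 := C.sum_norm_timeIntegral_le hd n hres hL hR k hq0 hq1 hLq ht htΔ hΔ hD
  have h2 : ∑ κ ∈ hfin.toFinset, ‖C.summand Q M (q ^ 4) t κ‖ ≤ B ^ (3 * C.order + 1) *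
      (Δ ^ C.order * (((2 * R + 9) * L) ^ d) ^ (2 * C.order) * (8 * q)) := by
    refine (Finset.sum_le_sum fun κ _ => C.norm_summand_le hQ hM (q ^ 4) t κ).trans ?_
    rw [← Finset.mul_sum]
    exact mul_le_mul_of_nonneg_left h1 (by positivity)
  set A := (2 * R + 9) ^ (2 * d) with hA
  have hA1 : 1 ≤ A := one_le_pow₀ (by linarith)
  have h3 : (((2 * R + 9) * L) ^ d) ^ (2 * C.order) = A ^ C.order * (L ^ (2 * d)) ^ C.order := by
    rw [hA, ← mul_pow, ← mul_pow, ← pow_mul, ← pow_mul]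
    congr 1
    ring
  rw [h3] at h2
  have hX : (1 : ℝ) ≤ 8 ^ C.order * B ^ 2 * Δ * A := by
    have h8 : (1 : ℝ) ≤ 8 ^ C.order := one_le_pow₀ (by norm_num)
    have hB2 : (1 : ℝ) ≤ B ^ 2 := one_le_pow₀ hB
    exact one_le_mul_of_one_le_of_one_le
      (one_le_mul_of_one_le_of_one_le (one_le_mul_of_one_le_of_one_le h8 hB2) hΔ) hA1
  calc _ ≤ ((L ^ (2 * d))⁻¹) ^ C.order * (B ^ (3 * C.order + 1) *
        (Δ ^ C.order * (A ^ C.order * (L ^ (2 * d)) ^ C.order) * (8 * q))) :=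
        mul_le_mul_of_nonneg_left h2 (by positivity)
    _ = B ^ (3 * C.order + 1) * Δ ^ C.order * A ^ C.order * 8 * q * 1 := by
        rw [inv_pow]
        field_simp
    _ ≤ B ^ (3 * C.order + 1) * Δ ^ C.order * A ^ C.order * 8 * q
        * (8 ^ C.order * B ^ 2 * Δ * A) := by
        refine mul_le_mul_of_nonneg_left hX ?_
        have : 0 ≤ A := by linarith
        positivity
    _ = _ := by
        rw [mul_pow, mul_pow, mul_pow, ← pow_mul]
        ring

end Couple

/-! ### Finiteness of the set of couples -/

theorem finite_card_nodes_le (n : ℕ) : {T : QuinTree | T.nodes.card ≤ n}.Finite := by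
  induction n with
  | zero =>
    refine (Set.finite_singleton QuinTree.leaf).subset fun T hT => ?_
    cases T with
    | leaf => rfl
    | node c => simp [QuinTree.nodes] at hT
  | succ n ih =>
    refine ((Set.finite_singleton QuinTree.leaf).union
      ((Set.Finite.pi' fun _ : Fin 5 => ih).image QuinTree.node)).subset fun T hT => ?_
    cases T with
    | leaf => exact Or.inl rfl
    | node c =>
      refine Or.inr ⟨c, fun i => ?_, rfl⟩
      change (QuinTree.node c).nodes.card ≤ n + 1 at hT
      rw [QuinTree.nodes, Finset.card_insert_of_notMem (by simp), card_biUnion_image_cons] at hT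
      have := Finset.single_le_sum (f := fun i => (c i).nodes.card) (fun _ _ => Nat.zero_le _)
        (Finset.mem_univ i)
      change (c i).nodes.card ≤ n
      linarith

theorem finite_couples (n : Fin 2 → ℕ) (ι : Fin 2 → ℤˣ) (η : Fin 2 → Fin 2) :
    (couples n ι η).Finite := by
  have htrees : {T : Fin 2 → SignedTree | ∀ s, T s ∈ (fun S : QuinTree => (⟨S, ι s, η s⟩ : SignedTree))
      '' {S | S.nodes.card ≤ n s}}.Finite :=
    Set.Finite.pi' fun s => (finite_card_nodes_le (n s)).image _
  refine (htrees.biUnion fun T _ => Set.finite_range fun σ : {σ : pairLeaves T → pairLeaves T //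
    Function.Involutive σ ∧ ∀ l, pairSign T (σ l).1 = - pairSign T l.1} =>
      (⟨T, σ.1, σ.2.1, σ.2.2⟩ : Couple)).subset fun C hC => ?_
  refine Set.mem_biUnion (x := C.tree) (fun s => ?_)
    ⟨⟨C.pairing, C.involutive, C.sign_pairing⟩, rfl⟩
  obtain ⟨h1, h2, h3⟩ := hC s
  refine ⟨(C.tree s).shape, h1.le, ?_⟩
  rw [← h2, ← h3]

end QuinticNLS

theorem mainTheorem2 (d : ℕ) (hd : 2 ≤ d) (β : ℝ) (hβ : 1 < β) :
    ∃ α : ℝ, 0 < α ∧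
    ∀ (R δ : ℝ), 0 < R → 0 < δ →
    ∀ (Q : Fin 2 → (Fin 5 → QuinticNLS.Vec d) → ℂ)
      (M : Fin 2 → Fin 2 → QuinticNLS.Vec d → ℂ),
    (∀ η, QuinticNLS.SobolevClass (Q η)) →
    (∀ η, QuinticNLS.SobolevClass (fun x => ((‖Q η x‖ : ℝ) : ℂ))) →
    (∀ η η', QuinticNLS.SobolevClass (M η η')) →
    (∀ η η' ξ, (starRingEnd ℂ) (M η η' ξ) = M η' η ξ) →
    (∀ η η' ξ, M η η' ξ ≠ 0 → ‖ξ‖ ≤ R) →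
    -- decay of every couple with at least one non-resonant node
    (∃ Λ : ℝ, 0 < Λ ∧
      ∀ C : QuinticNLS.Couple, (∃ n : C.Node, ¬ C.IsResonant d n.1) →
      ∀ L : ℝ, 1 ≤ L → ∀ k ∈ QuinticNLS.lattice d L, ∀ t ∈ Set.Icc (0 : ℝ) δ,
        ‖C.amplitude Q M L (L ^ (-(1 / β))) t k‖
          ≤ Λ ^ (C.order + 1) * (L ^ (-(1 / β))) ^ α) ∧
    -- at every order, only the fully resonant couples contribute as `L → ∞`
    (∀ (n : Fin 2 → ℕ) (ι : Fin 2 → ℤˣ) (η : Fin 2 → Fin 2),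
      ∀ e : ℝ, 0 < e → ∃ L₀ : ℝ, 1 ≤ L₀ ∧ ∀ L : ℝ, L₀ ≤ L →
        ∀ k ∈ QuinticNLS.lattice d L, ∀ t ∈ Set.Icc (0 : ℝ) δ,
        ‖(∑ᶠ C ∈ QuinticNLS.couples n ι η, C.amplitude Q M L (L ^ (-(1 / β))) t k) -
          ∑ᶠ C ∈ {C ∈ QuinticNLS.couples n ι η | C.FullyResonant d},
            C.amplitude Q M L (L ^ (-(1 / β))) t k‖ ≤ e) := by
  -- With the cut at `|Ω| = ε ^ (1/2)`, the near-resonant decorations contribute `ε ^ (1/4)` and the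
  -- others `ε ^ (1/2)`.
  refine ⟨1 / 4, by norm_num, fun R δ hR hδ Q M hQ _ hM _ hsupp => ?_⟩
  have hβ0 : 0 < β := by linarith
  obtain ⟨B, hB, hBQ, hBM⟩ : ∃ B : ℝ, 1 ≤ B ∧ (∀ η x, ‖Q η x‖ ≤ B) ∧
      ∀ η η' x, ‖M η η' x‖ ≤ B := by
    choose b hb using fun η => (hQ η).exists_bound
    choose c hc using fun η η' => (hM η η').exists_bound
    have hbn : ∀ η, 0 ≤ b η := fun η => (norm_nonneg _).trans (hb η 0)
    have hcn : ∀ η η', 0 ≤ c η η' := fun η η' => (norm_nonneg _).trans (hc η η' 0)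
    have hbs : ∀ η, b η ≤ ∑ η, b η := fun η =>
      Finset.single_le_sum (fun η _ => hbn η) (Finset.mem_univ η)
    have hcs : ∀ η η', c η η' ≤ ∑ η, ∑ η', c η η' := fun η η' =>
      (Finset.single_le_sum (fun η' _ => hcn η η') (Finset.mem_univ η')).trans
        (Finset.single_le_sum (f := fun η => ∑ η', c η η')
          (fun η _ => Finset.sum_nonneg fun η' _ => hcn η η') (Finset.mem_univ η))
    have hb0 : 0 ≤ ∑ η, b η := (hbn 0).trans (hbs 0)
    have hc0 : 0 ≤ ∑ η, ∑ η', c η η' := (hcn 0 0).trans (hcs 0 0)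
    refine ⟨1 + ∑ η, b η + ∑ η, ∑ η', c η η', by linarith, fun η x => ?_, fun η η' x => ?_⟩
    · linarith [hb η x, hbs η]
    · linarith [hc η η' x, hcs η η']
  set Λ : ℝ := 8 * B ^ 3 * max δ 1 * (2 * R + 9) ^ (2 * d) with hΛ
  have hΛ0 : 0 < Λ := by positivity
  have hbound : ∀ C : QuinticNLS.Couple, (∃ n : C.Node, ¬ C.IsResonant d n.1) →
      ∀ L : ℝ, 1 ≤ L → ∀ k : QuinticNLS.Vec d, ∀ t ∈ Set.Icc (0 : ℝ) δ,
        ‖C.amplitude Q M L (L ^ (-(1 / β))) t k‖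
          ≤ Λ ^ (C.order + 1) * (L ^ (-(1 / β))) ^ (1 / 4 : ℝ) := by
    rintro C ⟨n, hn⟩ L hL k t ht
    have hL0 : 0 < L := by linarith
    set ε := L ^ (-(1 / β)) with hε
    have hε0 : 0 < ε := Real.rpow_pos_of_pos hL0 _
    have hε1 : ε ≤ 1 := Real.rpow_le_one_of_one_le_of_nonpos hL (by simp [hβ0.le])
    -- Here `β > 1` enters: the lattice spacing is finer than `ε`.
    have hLε : 1 / L ≤ ε := by
      rw [one_div, ← Real.rpow_neg_one]
      refine Real.rpow_le_rpow_of_exponent_le hL (neg_le_neg ?_)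
      rw [div_le_one hβ0]; exact hβ.le
    have hq4 : ε = (ε ^ (1 / 4 : ℝ)) ^ 4 := by
      rw [← Real.rpow_natCast, ← Real.rpow_mul hε0.le]
      norm_num
    have hεq : ε ≤ ε ^ (1 / 4 : ℝ) := by
      conv_lhs => rw [← Real.rpow_one ε]
      exact Real.rpow_le_rpow_of_exponent_ge hε0 hε1 (by norm_num)
    have h := C.norm_amplitude_le (by linarith) n hn hB hBQ hBM hL hR.le hsupp k
      (Real.rpow_pos_of_pos hε0 (1 / 4 : ℝ)) (Real.rpow_le_one hε0.le hε1 (by norm_num))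
      (hLε.trans hεq) ht.1 (ht.2.trans (le_max_left δ 1)) (le_max_right δ 1)
    rwa [← hq4] at h
  refine ⟨⟨Λ, hΛ0, fun C hC L hL k _ t ht => hbound C hC L hL k t ht⟩, ?_⟩
  intro n ι η e he
  have hfin := QuinticNLS.finite_couples n ι η
  set S := QuinticNLS.couples n ι η with hS
  set S' := {C ∈ S | C.FullyResonant d} with hS'
  have hdfin : (S \ S').Finite := hfin.subset Set.sdiff_subset
  set K : ℝ := hdfin.toFinset.card * Λ ^ (n 0 + n 1 + 1) with hK
  have hlim : Filter.Tendsto (fun L : ℝ => K * (L ^ (-(1 / β))) ^ (1 / 4 : ℝ)) Filter.atTop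
      (nhds 0) := by
    have h1 := (tendsto_rpow_neg_atTop (y := 1 / β) (by positivity)).rpow_const
      (p := 1 / 4) (Or.inr (by norm_num))
    rw [Real.zero_rpow (by norm_num)] at h1
    simpa using h1.const_mul K
  obtain ⟨L₁, hL₁⟩ := Filter.eventually_atTop.1 (hlim.eventually_le_const he)
  refine ⟨max L₁ 1, le_max_right _ _, fun L hL k _ t ht => ?_⟩
  have hL1 : 1 ≤ L := (le_max_right _ _).trans hL
  -- The difference is the finite sum over couples with a non-resonant node, all of order `n 0 + n
  -- 1`, so a single constant `K` serves for every `k` and `t`.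
  rw [← finsum_mem_add_sdiff (s := S') (t := S) (fun C hC => hC.1) hfin, add_sub_cancel_left,
    finsum_mem_eq_finite_toFinset_sum _ hdfin]
  refine le_trans ?_ (hL₁ L ((le_max_left _ _).trans hL))
  refine (norm_sum_le_of_le _ (f := fun C : QuinticNLS.Couple => C.amplitude Q M L (L ^ (-(1 / β))) t k)
    (n := fun _ : QuinticNLS.Couple => Λ ^ (n 0 + n 1 + 1) * (L ^ (-(1 / β))) ^ (1 / 4 : ℝ)) fun C hC => ?_).trans ?_
  · rw [Set.Finite.mem_toFinset] at hC
    have hex : ∃ n : C.Node, ¬ C.IsResonant d n.1 := by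
      by_contra! h
      exact hC.2 ⟨hC.1, h⟩
    have horder : C.order = n 0 + n 1 := by
      rw [C.card_nodes_eq, Fin.sum_univ_two, (hC.1 0).1, (hC.1 1).1]
    have h := hbound C hex L hL1 k t ht
    rwa [horder] at h
  · rw [Finset.sum_const, nsmul_eq_mul, hK, mul_assoc]
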